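/- Consider a merchant with initial inventory $x^1=1$, storage cost $C(x)=\tfrac12x^2$ and discount factor $\beta\in(0,1)$ who, at each time $t\in\mathbb N$, observes a price $p^t$ and chooses the next inventory level $x^{t+1}\in[0,x^t]$, earning $p^t(x^t-x^{t+1})-C(x^{t+1})$. For a probability distribution $Q$ on $\mathbb R$, consider the functional equation $$v(x,p)=\sup_{0\le y\le x}\bigl\{p(x-y)-C(y)+\beta\,\mathbb E_{q\sim Q}[v(y,q)]\bigr\}\qquad\text{for all }(x,p)\in\mathbb R_+\times\mathbb R .$$ Given price samples $s=(s_1,\dots,s_N)$, a sample-based SDP policy is a function $y_{\mathrm S}(\cdot,\cdot\,;s):\mathbb R_+\times\mathbb R\to\mathbb R_+$ that selects, for every $(x,p)$, a maximizer of the right-hand side, where $Q$ is the empirical distribution of $s_1,\dots,s_N$ and $v$ is a continuous solution of the equation. A sample-based MPC policy $y_{\mathrm M}(\cdot,\cdot\,;s)$ is defined in the same way, with $Q$ the point mass at the sample average $\frac1N\sum_{i=1}^N s_i$. The out-of-sample performance of a policy $y$ is $$V_y(x^1)=\mathbb E_{P^\infty}\Bigl[\,\sum_{t=1}^\infty\beta^{t-1}\bigl(p^t(x^t-x^{t+1})-C(x^{t+1})\bigr)\Bigr],\qquad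 x^{t+1}=y(x^t,p^t),$$ where the prices $p^1,p^2,\dots$ are independent with the $\mathrm{Exponential}(1)$ distribution $P$. The expected out-of-sample performance of a sample-based policy is the expectation of $V_{y(\cdot,\cdot\,;s)}(1)$ over independent samples $s_1,\dots,s_N$ distributed according to $P$. Let $N\ge2$. For every $\beta\in(0,1)$ sample-based SDP and MPC policies exist for all samples $s\in\mathbb R^N$, and their expected out-of-sample performances $J_{\mathrm S}(\beta)$ and $J_{\mathrm M}(\beta)$ are well defined (all series and expectations converge absolutely). Moreover, $$\lim_{\beta\to1^-}J_{\mathrm S}(\beta)=-\infty,\qquad\text{whereas}\qquad \sup_{\beta\in(0,1)}\bigl|J_{\mathrm M}(\beta)\bigr|<\infty .$$ -/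

import Mathlib

open MeasureTheory ProbabilityTheory Filter Topology Set
open scoped ENNReal

noncomputable section

namespace RevenueOpt

/-- The exponential distribution with rate `1` is a probability measure. -/
instance isProbabilityMeasure_exp_one : IsProbabilityMeasure (expMeasure 1) :=
  isProbabilityMeasure_expMeasure one_pos

/-- The right-hand side objective of the Bellman equation: starting from inventory `x` at price `p`,
sell down to `y`, pay the storage cost `C y`, and continue with value function `v`, where future
prices have distribution `Q`. -/
def bellmanObjective (β : ℝ) (C : ℝ → ℝ) (Q : Measure ℝ) (v : ℝ → ℝ → ℝ) (x p y : ℝ) : ℝ :=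
  p * (x - y) - C y + β * ∫ q, v y q ∂Q

/-- `v`, a function on `[0, ∞) × ℝ` (its values at negative inventories are irrelevant), is a
continuous solution of the functional equation
`v(x, p) = sup_{0 ≤ y ≤ x} { p (x - y) - C(y) + β E_Q[v(y, ·)] }`. -/
def IsValueFunction (β : ℝ) (C : ℝ → ℝ) (Q : Measure ℝ) (v : ℝ → ℝ → ℝ) : Prop :=
  ContinuousOn (fun z : ℝ × ℝ => v z.1 z.2) (Ici 0 ×ˢ univ) ∧
  ∀ x : ℝ, 0 ≤ x → ∀ p : ℝ, IsLUB (bellmanObjective β C Q v x p '' Icc 0 x) (v x p)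

/-- `y` (inventory and price to next inventory) is a policy obtained by solving the functional
equation with price distribution `Q`: it picks a maximizer of the right-hand side in every state. -/
def IsDPPolicy (β : ℝ) (C : ℝ → ℝ) (Q : Measure ℝ) (y : ℝ → ℝ → ℝ) : Prop :=
  ∃ v : ℝ → ℝ → ℝ, IsValueFunction β C Q v ∧
    ∀ x : ℝ, 0 ≤ x → ∀ p : ℝ,
      y x p ∈ Icc 0 x ∧ IsMaxOn (bellmanObjective β C Q v x p) (Icc 0 x) (y x p)

/-- The empirical distribution of the price samples `s 0, …, s (N - 1)`. -/
def empiricalMeasure {N : ℕ} (s : Fin N → ℝ) : Measure ℝ :=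
  (N : ℝ≥0∞)⁻¹ • ∑ i, Measure.dirac (s i)

/-- The sample average. -/
def sampleMean {N : ℕ} (s : Fin N → ℝ) : ℝ := (∑ i, s i) / N

/-- Sample-based SDP policy: the price distribution is replaced by the empirical distribution. -/
def IsSDPPolicy {N : ℕ} (β : ℝ) (C : ℝ → ℝ) (s : Fin N → ℝ) (y : ℝ → ℝ → ℝ) : Prop :=
  IsDPPolicy β C (empiricalMeasure s) y

/-- Sample-based MPC policy: the price distribution is replaced by the point mass at the sample
average. -/
def IsMPCPolicy {N : ℕ} (β : ℝ) (C : ℝ → ℝ) (s : Fin N → ℝ) (y : ℝ → ℝ → ℝ) : Prop :=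
  IsDPPolicy β C (Measure.dirac (sampleMean s)) y

/-- Inventory levels when following the policy `y` from `x₁` along the prices `p`
(times start at `0`). -/
def inventory (y : ℝ → ℝ → ℝ) (x₁ : ℝ) (p : ℕ → ℝ) : ℕ → ℝ
  | 0 => x₁
  | t + 1 => y (inventory y x₁ p t) (p t)

/-- Discounted reward earned at time `t`: sales revenue minus storage cost. -/
def stageReward (β : ℝ) (C : ℝ → ℝ) (y : ℝ → ℝ → ℝ) (x₁ : ℝ) (p : ℕ → ℝ) (t : ℕ) : ℝ :=
  β ^ t * (p t * (inventory y x₁ p t - inventory y x₁ p (t + 1)) - C (inventory y x₁ p (t + 1)))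

/-- Total discounted reward along a price path. -/
def totalReward (β : ℝ) (C : ℝ → ℝ) (y : ℝ → ℝ → ℝ) (x₁ : ℝ) (p : ℕ → ℝ) : ℝ :=
  ∑' t, stageReward β C y x₁ p t

/-- Out-of-sample performance of the policy `y`: expected total discounted reward when the prices
are i.i.d. with the true distribution `P`. -/
def performance (P : Measure ℝ) [IsProbabilityMeasure P] (β : ℝ) (C : ℝ → ℝ)
    (y : ℝ → ℝ → ℝ) (x₁ : ℝ) : ℝ :=
  ∫ p, totalReward β C y x₁ p ∂(Measure.infinitePi fun _ : ℕ => P)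

/-- Expected out-of-sample performance of a sample-dependent policy, over `N` i.i.d. samples
from `P`. -/
def expectedPerformance {N : ℕ} (P : Measure ℝ) [IsProbabilityMeasure P] (β : ℝ) (C : ℝ → ℝ)
    (y : (Fin N → ℝ) → ℝ → ℝ → ℝ) (x₁ : ℝ) : ℝ :=
  ∫ s, performance P β C (y s) x₁ ∂(Measure.pi fun _ : Fin N => P)

/-- All series and expectations in the definition of the expected out-of-sample performance
converge absolutely. -/
def PerformanceWellDefined {N : ℕ} (P : Measure ℝ) [IsProbabilityMeasure P] (β : ℝ) (C : ℝ → ℝ)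
    (y : (Fin N → ℝ) → ℝ → ℝ → ℝ) (x₁ : ℝ) : Prop :=
  (∀ s : Fin N → ℝ,
    (∀ᵐ p ∂(Measure.infinitePi fun _ : ℕ => P), Summable (stageReward β C (y s) x₁ p)) ∧
    Integrable (totalReward β C (y s) x₁) (Measure.infinitePi fun _ : ℕ => P)) ∧
  Integrable (fun s => performance P β C (y s) x₁) (Measure.pi fun _ : Fin N => P)

/-- The quadratic storage cost `x ↦ x² / 2`. -/
def quadCost (x : ℝ) : ℝ := x ^ 2 / 2

end RevenueOpt

end

noncomputable section

namespace RevenueOpt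

/-! ### Suprema of real functions -/

/-! Both policies come from the same dynamic program: MPC is SDP run on a single sample, the sample
mean. Let `M` be the largest sample given to the program. At a price of at least `M` everything is
sold (`optPolicy_eq_zero`), because the continuation value is at most `M` times the inventory
(`valueFn_le`).

For MPC, `M` is the sample mean, and the true waiting time for a price above it has expectation `exp
M`. The reward is therefore bounded by a multiple of `exp M`, uniformly in `β`
(`abs_performance_le`). This is integrable over the samples, since each sample enters the exponent
with weight `1 / N < 1` (`integrable_exp_sampleMean`).

For SDP, `M` is the sample maximum, which the program believes to recur with probability at least `1
/ N` per period. Waiting for it looks cheap, so for `β` near one an amount `1 / (4 * N)` is held as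
long as prices stay below `M - 1` (`le_optPolicy`). In truth the wait lasts about `exp (M - 1)`
periods, and storage costs of that order accrue (`performance_le`, `exp_le_expected_holding_time`),
while revenue is only `O(exp (M / 2))`. The expectation of `exp M` diverges because the exponential
cancels the density `exp (-x)`: restricting the maximal sample to `[2, K]` already gives a multiple
of `K - 2` (`integral_topSampleWeight`). With `K` fixed first and `β` then close to one, the
performance falls below any bound.

The quadratic cost makes the Bellman objective strictly concave, so maximizers are unique. Hence
every SDP or MPC policy agrees with `optPolicy` on nonnegative inventories, and measurability in the
sample follows from joint continuity of the value function. -/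

lemma abs_sub_le_of_isLUB_image {α : Type*} {S : Set α} {f g : α → ℝ}
    {A B δ : ℝ} (hf : IsLUB (f '' S) A) (hg : IsLUB (g '' S) B)
    (h : ∀ y ∈ S, |f y - g y| ≤ δ) : |A - B| ≤ δ := by
  rw [abs_le]
  constructor
  · have : B ≤ A + δ := hg.2 (by
      rintro _ ⟨y, hy, rfl⟩
      have h1 := (abs_le.1 (h y hy)).1
      have h2 := hf.1 (mem_image_of_mem f hy)
      linarith)
    linarith
  · have : A ≤ B + δ := hf.2 (by
      rintro _ ⟨y, hy, rfl⟩
      have h1 := (abs_le.1 (h y hy)).2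
      have h2 := hg.1 (mem_image_of_mem g hy)
      linarith)
    linarith

lemma abs_average_sub_le {N : ℕ} {u v : Fin N → ℝ} {δ : ℝ} (hδ : 0 ≤ δ)
    (h : ∀ i, |u i - v i| ≤ δ) : |(∑ i, u i) / N - (∑ i, v i) / N| ≤ δ := by
  rcases Nat.eq_zero_or_pos N with rfl | hN
  · simpa using hδ
  have hN' : (0 : ℝ) < N := by exact_mod_cast hN
  rw [← sub_div, ← Finset.sum_sub_distrib, abs_div, abs_of_pos hN', div_le_iff₀ hN']
  calc |∑ i, (u i - v i)| ≤ ∑ i, |u i - v i| := Finset.abs_sum_le_sum_abs _ _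
    _ ≤ ∑ _i : Fin N, δ := Finset.sum_le_sum fun i _ => h i
    _ = δ * N := by simp [mul_comm]

/-! ### The Bellman operator of a finitely supported price distribution -/

/-- The Bellman objective, written in terms of the expected continuation value `w`. -/
def objective (β : ℝ) (w : ℝ → ℝ) (x p y : ℝ) : ℝ := p * (x - y) - quadCost y + β * w y

/-- The supremum of the objective over the next inventory levels `y` between `0` and `z`. -/
def objectiveSup (β : ℝ) (w : ℝ → ℝ) (x p z : ℝ) : ℝ :=
  sSup ((fun θ => objective β w x p (θ * z)) '' Icc 0 1)

lemma image_mul_Icc_zero_one {z : ℝ} (hz : 0 ≤ z) : (fun θ : ℝ => θ * z) '' Icc 0 1 = Icc 0 z := by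
  ext y
  constructor
  · rintro ⟨θ, ⟨h0, h1⟩, rfl⟩
    exact ⟨by positivity, by simpa using mul_le_mul_of_nonneg_right h1 hz⟩
  · rintro ⟨h0, h1⟩
    rcases hz.eq_or_lt with rfl | hz
    · exact ⟨0, by simp, by simp; linarith⟩
    · exact ⟨y / z, ⟨by positivity, (div_le_one hz).2 h1⟩, by field_simp⟩

lemma continuous_quadCost : Continuous quadCost := by unfold quadCost; fun_prop

lemma continuous_objective {β : ℝ} {w : ℝ → ℝ} (hw : Continuous w) (x p : ℝ) :
    Continuous (objective β w x p) := by
  have := continuous_quadCost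
  unfold objective; fun_prop

lemma isGreatest_objectiveSup {β : ℝ} {w : ℝ → ℝ} (hw : Continuous w) (x p z : ℝ) :
    IsGreatest ((fun θ => objective β w x p (θ * z)) '' Icc 0 1) (objectiveSup β w x p z) := by
  have hc : Continuous (fun θ => objective β w x p (θ * z)) :=
    (continuous_objective hw x p).comp (by fun_prop)
  exact ((isCompact_Icc.image hc).isGreatest_sSup (by simp))

lemma isGreatest_objectiveSup_Icc {β : ℝ} {w : ℝ → ℝ} (hw : Continuous w) (x p : ℝ) {z : ℝ}
    (hz : 0 ≤ z) : IsGreatest (objective β w x p '' Icc 0 z) (objectiveSup β w x p z) := by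
  have h := isGreatest_objectiveSup (β := β) hw x p z
  rw [← image_mul_Icc_zero_one hz, image_image]
  exact h

lemma objective_le_objectiveSup {β : ℝ} {w : ℝ → ℝ} (hw : Continuous w) (x p : ℝ) {y z : ℝ}
    (hy : y ∈ Icc 0 z) : objective β w x p y ≤ objectiveSup β w x p z :=
  (isGreatest_objectiveSup_Icc hw x p (hy.1.trans hy.2)).2 (mem_image_of_mem _ hy)

/-- Writing the decision as `θ * z` with `θ` in `[0, 1]` makes the constraint set independent of the
state, so compactness gives joint continuity in all parameters, including the sample carried by `w`.
-/
lemma continuous_objectiveSup {X : Type*} [TopologicalSpace X] {β : ℝ} {w : X → ℝ → ℝ}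
    (hw : Continuous fun q : X × ℝ => w q.1 q.2) {x p z : X → ℝ} (hx : Continuous x)
    (hp : Continuous p) (hz : Continuous z) :
    Continuous fun a => objectiveSup β (w a) (x a) (p a) (z a) := by
  have hQ := continuous_quadCost
  refine IsCompact.continuous_sSup (K := Icc (0 : ℝ) 1)
    (f := fun a θ => objective β (w a) (x a) (p a) (θ * z a)) isCompact_Icc ?_
  have h : Continuous fun q : X × ℝ => w q.1 (q.2 * z q.1) :=
    hw.comp (g := fun q : X × ℝ => w q.1 q.2)
      (f := fun q : X × ℝ => (q.1, q.2 * z q.1)) (by fun_prop)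
  unfold objective
  simp only [Function.HasUncurry.uncurry, id]
  fun_prop

/-- The Bellman operator for the empirical distribution of `a`, acting on expected continuation
values. -/
def bellmanOp {N : ℕ} (β : ℝ) (a : Fin N → ℝ) (w : ℝ → ℝ) (x : ℝ) : ℝ :=
  (∑ i, objectiveSup β w x (a i) x) / N

/-- Value iteration started at `0`. -/
def valueIter {N : ℕ} (β : ℝ) (a : Fin N → ℝ) : ℕ → ℝ → ℝ
  | 0 => 0
  | n + 1 => bellmanOp β a (valueIter β a n)

/-- A bound for the first step of value iteration. -/
def valueBound {N : ℕ} (a : Fin N → ℝ) (x : ℝ) : ℝ := (∑ i, |a i|) * |x| + x ^ 2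

/-! ### Value iteration: convergence, joint continuity and concavity. -/

section ValueFunction

variable {N : ℕ}

lemma continuous_bellmanOp {X : Type*} [TopologicalSpace X] {β : ℝ} {w : X → ℝ → ℝ}
    (hw : Continuous fun q : X × ℝ => w q.1 q.2) {a : X → Fin N → ℝ} (ha : Continuous a) :
    Continuous fun q : X × ℝ => bellmanOp β (a q.1) (w q.1) q.2 := by
  unfold bellmanOp
  refine Continuous.div_const (continuous_finsetSum _ fun i _ => ?_) _
  refine continuous_objectiveSup (X := X × ℝ) (w := fun q => w q.1) (p := fun q => a q.1 i)
    (x := Prod.snd) (z := Prod.snd) ?_ ?_ ?_ ?_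
  · exact hw.comp (g := fun q : X × ℝ => w q.1 q.2)
      (f := fun q : (X × ℝ) × ℝ => (q.1.1, q.2)) (by fun_prop)
  all_goals fun_prop

lemma continuous_valueIter_prod (β : ℝ) (n : ℕ) :
    Continuous fun q : (Fin N → ℝ) × ℝ => valueIter β q.1 n q.2 := by
  induction n with
  | zero => exact continuous_const
  | succ n ih =>
    exact continuous_bellmanOp (X := Fin N → ℝ) (a := id)
      (w := fun a => valueIter β a n) ih continuous_id

lemma continuous_valueIter (β : ℝ) (a : Fin N → ℝ) (n : ℕ) : Continuous (valueIter β a n) :=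
  (continuous_valueIter_prod β n).comp (f := fun x : ℝ => (a, x)) (by fun_prop)

lemma valueBound_nonneg (a : Fin N → ℝ) (x : ℝ) : 0 ≤ valueBound a x := by
  unfold valueBound
  have : 0 ≤ ∑ i, |a i| := Finset.sum_nonneg fun i _ => abs_nonneg _
  positivity

lemma valueBound_mul_le (a : Fin N → ℝ) (x : ℝ) {θ : ℝ} (hθ : θ ∈ Icc (0 : ℝ) 1) :
    valueBound a (θ * x) ≤ valueBound a x := by
  unfold valueBound
  have h0 : 0 ≤ ∑ i, |a i| := Finset.sum_nonneg fun i _ => abs_nonneg _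
  have h1 : |θ * x| ≤ |x| := by
    rw [abs_mul, abs_of_nonneg hθ.1]
    exact mul_le_of_le_one_left (abs_nonneg _) hθ.2
  have h2 : (θ * x) ^ 2 ≤ x ^ 2 := sq_le_sq.2 h1
  gcongr

/-- The contraction estimate is local: the operator at `x` only sees levels in `[0, x]`. This
replaces a sup norm, which would be infinite on unbounded inventories. -/
lemma abs_bellmanOp_sub_le {β : ℝ} (hβ : 0 ≤ β) (a : Fin N → ℝ) {w₁ w₂ : ℝ → ℝ}
    (h₁ : Continuous w₁) (h₂ : Continuous w₂) {x δ : ℝ} (hδ : 0 ≤ δ)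
    (h : ∀ θ ∈ Icc (0 : ℝ) 1, |w₁ (θ * x) - w₂ (θ * x)| ≤ δ) :
    |bellmanOp β a w₁ x - bellmanOp β a w₂ x| ≤ β * δ := by
  refine abs_average_sub_le (by positivity) fun i => ?_
  refine abs_sub_le_of_isLUB_image (S := Icc (0 : ℝ) 1)
    (isGreatest_objectiveSup h₁ x (a i) x).isLUB (isGreatest_objectiveSup h₂ x (a i) x).isLUB ?_
  intro θ hθ
  have : objective β w₁ x (a i) (θ * x) - objective β w₂ x (a i) (θ * x)
      = β * (w₁ (θ * x) - w₂ (θ * x)) := by unfold objective; ring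
  rw [this, abs_mul, abs_of_nonneg hβ]
  exact mul_le_mul_of_nonneg_left (h θ hθ) hβ

lemma abs_bellmanOp_zero_le (β : ℝ) (a : Fin N → ℝ) (x : ℝ) :
    |bellmanOp β a 0 x| ≤ valueBound a x := by
  have h := abs_average_sub_le (u := fun i => objectiveSup β 0 x (a i) x) (v := fun _ => 0)
    (valueBound_nonneg a x) (fun i => ?_)
  · simpa [bellmanOp] using h
  obtain ⟨θ, hθ, hθ'⟩ := (isGreatest_objectiveSup (β := β) continuous_zero x (a i) x).1
  have hi : |a i| ≤ ∑ i, |a i| :=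
    Finset.single_le_sum (f := fun i => |a i|) (fun i _ => abs_nonneg _) (Finset.mem_univ i)
  have h1 : |x - θ * x| ≤ |x| := by
    rw [show x - θ * x = (1 - θ) * x by ring, abs_mul, abs_of_nonneg (by linarith [hθ.2])]
    exact mul_le_of_le_one_left (abs_nonneg _) (by linarith [hθ.1])
  have h2 : (θ * x) ^ 2 ≤ x ^ 2 := by
    rw [mul_pow]
    exact mul_le_of_le_one_left (by positivity) (pow_le_one₀ hθ.1 hθ.2)
  have h3 : |a i * (x - θ * x)| ≤ (∑ i, |a i|) * |x| := by
    rw [abs_mul]; gcongr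
  dsimp only at hθ' ⊢
  rw [sub_zero, ← hθ', objective, quadCost, Pi.zero_apply, mul_zero, add_zero, valueBound]
  rw [abs_le] at h3 ⊢
  constructor <;> nlinarith [sq_nonneg (θ * x)]

lemma dist_valueIter_succ_le {β : ℝ} (hβ : β ∈ Ioo (0 : ℝ) 1) (a : Fin N → ℝ) (n : ℕ) (x : ℝ) :
    dist (valueIter β a n x) (valueIter β a (n + 1) x) ≤ valueBound a x * β ^ n := by
  rw [dist_comm, Real.dist_eq]
  induction n generalizing x with
  | zero => simpa [valueIter] using abs_bellmanOp_zero_le β a x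
  | succ n ih =>
    have hβ0 := hβ.1.le
    have hb := valueBound_nonneg a x
    have := abs_bellmanOp_sub_le hβ0 a (continuous_valueIter β a (n + 1))
      (continuous_valueIter β a n) (x := x) (δ := valueBound a x * β ^ n) (by positivity)
      (fun θ hθ => (ih (θ * x)).trans
        (mul_le_mul_of_nonneg_right (valueBound_mul_le a x hθ) (by positivity)))
    calc _ ≤ _ := this
      _ = _ := by ring

/-- The limit of value iteration: the expected continuation value `E_Q[v(x, ·)]`. -/
def valueFn (β : ℝ) (a : Fin N → ℝ) (x : ℝ) : ℝ := limUnder atTop fun n => valueIter β a n x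

lemma tendsto_valueIter {β : ℝ} (hβ : β ∈ Ioo (0 : ℝ) 1) (a : Fin N → ℝ) (x : ℝ) :
    Tendsto (fun n => valueIter β a n x) atTop (𝓝 (valueFn β a x)) :=
  CauchySeq.tendsto_limUnder (cauchySeq_of_le_geometric β (valueBound a x) hβ.2
    fun n => dist_valueIter_succ_le hβ a n x)

lemma dist_valueIter_valueFn_le {β : ℝ} (hβ : β ∈ Ioo (0 : ℝ) 1) (a : Fin N → ℝ) (n : ℕ) (x : ℝ) :
    dist (valueIter β a n x) (valueFn β a x) ≤ valueBound a x * β ^ n / (1 - β) :=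
  dist_le_of_le_geometric_of_tendsto β _ hβ.2 (fun n => dist_valueIter_succ_le hβ a n x)
    (tendsto_valueIter hβ a x) n

lemma continuous_valueBound : Continuous fun q : (Fin N → ℝ) × ℝ => valueBound q.1 q.2 := by
  unfold valueBound; fun_prop

/-- The geometric error bound has a continuous prefactor, so value iteration converges locally
uniformly in sample and inventory together. -/
lemma continuous_valueFn_prod {β : ℝ} (hβ : β ∈ Ioo (0 : ℝ) 1) :
    Continuous fun q : (Fin N → ℝ) × ℝ => valueFn β q.1 q.2 := by
  have hT : TendstoLocallyUniformly (fun n (q : (Fin N → ℝ) × ℝ) => valueIter β q.1 n q.2)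
      (fun q => valueFn β q.1 q.2) atTop := by
    rw [Metric.tendstoLocallyUniformly_iff]
    intro ε hε q
    refine ⟨{r | valueBound r.1 r.2 < valueBound q.1 q.2 + 1},
      (isOpen_lt continuous_valueBound continuous_const).mem_nhds (by simp), ?_⟩
    have h1β : 0 < 1 - β := by linarith [hβ.2]
    have hlim : Tendsto (fun n : ℕ => (valueBound q.1 q.2 + 1) * β ^ n / (1 - β)) atTop (𝓝 0) := by
      simpa using ((tendsto_pow_atTop_nhds_zero_of_lt_one hβ.1.le hβ.2).const_mul
        (valueBound q.1 q.2 + 1)).div_const (1 - β)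
    filter_upwards [hlim.eventually (gt_mem_nhds hε)] with n hn r hr
    rw [dist_comm]
    refine (dist_valueIter_valueFn_le hβ r.1 n r.2).trans_lt (lt_of_le_of_lt ?_ hn)
    have hr' : valueBound r.1 r.2 ≤ valueBound q.1 q.2 + 1 := le_of_lt hr
    have := hβ.1.le
    gcongr
  exact hT.continuous (Frequently.of_forall fun n => continuous_valueIter_prod β n)

lemma continuous_valueFn {β : ℝ} (hβ : β ∈ Ioo (0 : ℝ) 1) (a : Fin N → ℝ) :
    Continuous (valueFn β a) :=
  (continuous_valueFn_prod hβ).comp (f := fun x : ℝ => (a, x)) (by fun_prop)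

lemma bellmanOp_valueFn {β : ℝ} (hβ : β ∈ Ioo (0 : ℝ) 1) (a : Fin N → ℝ) (x : ℝ) :
    bellmanOp β a (valueFn β a) x = valueFn β a x := by
  have h1 : Tendsto (fun n => valueIter β a (n + 1) x) atTop (𝓝 (valueFn β a x)) :=
    (tendsto_add_atTop_iff_nat 1).2 (tendsto_valueIter hβ a x)
  refine tendsto_nhds_unique ?_ h1
  have h1β : 0 < 1 - β := by linarith [hβ.2]
  have hβ0 := hβ.1.le
  have hb := valueBound_nonneg a x
  have hlim : Tendsto (fun n : ℕ => β * (valueBound a x * β ^ n / (1 - β))) atTop (𝓝 0) := by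
    simpa using (((tendsto_pow_atTop_nhds_zero_of_lt_one hβ.1.le hβ.2).const_mul
        (valueBound a x)).div_const (1 - β)).const_mul β
  refine tendsto_iff_dist_tendsto_zero.2
    (squeeze_zero (fun _ => dist_nonneg) (fun n => ?_) hlim)
  rw [Real.dist_eq]
  refine abs_bellmanOp_sub_le hβ0 a (continuous_valueIter β a n) (continuous_valueFn hβ a)
    (by positivity) fun θ hθ => ?_
  have := dist_valueIter_valueFn_le hβ a n (θ * x)
  rw [Real.dist_eq] at this
  refine this.trans ?_
  have := valueBound_mul_le a x hθ
  gcongr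

/-- A convex combination of optimal decisions at two inventories is feasible at the combined
inventory, and the storage cost is convex. -/
lemma bellmanOp_concaveOn {β : ℝ} (hβ : 0 ≤ β) (a : Fin N → ℝ) {w : ℝ → ℝ} (hw : Continuous w)
    (hc : ConcaveOn ℝ (Ici 0) w) : ConcaveOn ℝ (Ici 0) (bellmanOp β a w) := by
  refine ⟨convex_Ici 0, fun x hx y hy r t hr ht hrt => ?_⟩
  simp only [mem_Ici, smul_eq_mul] at *
  unfold bellmanOp
  rw [← mul_div_assoc, ← mul_div_assoc, ← add_div, Finset.mul_sum, Finset.mul_sum,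
    ← Finset.sum_add_distrib]
  gcongr with i
  obtain ⟨y₁, ⟨h10, h11⟩, hy₁⟩ := (isGreatest_objectiveSup_Icc (β := β) hw x (a i) hx).1
  obtain ⟨y₂, ⟨h20, h21⟩, hy₂⟩ := (isGreatest_objectiveSup_Icc (β := β) hw y (a i) hy).1
  rw [← hy₁, ← hy₂]
  refine le_trans ?_ (objective_le_objectiveSup hw _ (a i) (y := r * y₁ + t * y₂)
    ⟨by positivity, by gcongr⟩)
  have h := hc.2 (x := y₁) (y := y₂) h10 h20 hr ht hrt
  simp only [smul_eq_mul] at h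
  unfold objective quadCost
  have hq : (r * y₁ + t * y₂) ^ 2 ≤ r * y₁ ^ 2 + t * y₂ ^ 2 := by
    have : r * y₁ ^ 2 + t * y₂ ^ 2 - (r * y₁ + t * y₂) ^ 2 = r * t * (y₁ - y₂) ^ 2 := by
      obtain rfl : t = 1 - r := by linarith
      ring
    nlinarith [mul_nonneg (mul_nonneg hr ht) (sq_nonneg (y₁ - y₂))]
  nlinarith [mul_le_mul_of_nonneg_left h hβ]

lemma concaveOn_valueFn {β : ℝ} (hβ : β ∈ Ioo (0 : ℝ) 1) (a : Fin N → ℝ) :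
    ConcaveOn ℝ (Ici 0) (valueFn β a) := by
  have h : ∀ n, ConcaveOn ℝ (Ici 0) (valueIter β a n) := by
    intro n
    induction n with
    | zero => exact concaveOn_const 0 (convex_Ici 0)
    | succ n ih => exact bellmanOp_concaveOn hβ.1.le a (continuous_valueIter β a n) ih
  refine ⟨convex_Ici 0, fun x hx y hy r t hr ht hrt => ?_⟩
  exact le_of_tendsto_of_tendsto'
    (((tendsto_valueIter hβ a x).const_mul r).add ((tendsto_valueIter hβ a y).const_mul t))
    (tendsto_valueIter hβ a _) fun n => (h n).2 hx hy hr ht hrt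

lemma strictConcaveOn_objective {β : ℝ} (hβ : 0 ≤ β) {w : ℝ → ℝ} (hc : ConcaveOn ℝ (Ici 0) w)
    (x p : ℝ) : StrictConcaveOn ℝ (Ici 0) (objective β w x p) := by
  refine ⟨convex_Ici 0, fun y₁ h₁ y₂ h₂ hne r t hr ht hrt => ?_⟩
  have h := hc.2 h₁ h₂ hr.le ht.le hrt
  simp only [smul_eq_mul] at h ⊢
  have hq : 0 < r * t * (y₁ - y₂) ^ 2 := by
    have := sub_ne_zero.2 hne
    positivity
  have h' := mul_le_mul_of_nonneg_left h hβ
  obtain rfl : t = 1 - r := by linarith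
  unfold objective quadCost
  nlinarith

end ValueFunction

/-! ### Uniqueness of the value function -/

section Uniqueness

variable {N : ℕ}

lemma integral_empiricalMeasure (a : Fin N → ℝ) (f : ℝ → ℝ) :
    ∫ q, f q ∂(empiricalMeasure a) = (∑ i, f (a i)) / N := by
  unfold empiricalMeasure
  rw [integral_smul_measure, integral_finsetSum_measure fun i _ => integrable_dirac (by simp)]
  simp [div_eq_inv_mul]

lemma bellmanObjective_eq (β : ℝ) (Q : Measure ℝ) (v : ℝ → ℝ → ℝ) (x p : ℝ) :
    bellmanObjective β quadCost Q v x p = objective β (fun y => ∫ q, v y q ∂Q) x p := rfl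

/-- No growth condition is needed, since inventories never increase. On `[0, X]` the gap between the
two functions attains a maximum `d`, and the two Bellman equations at that point give `d ≤ β * d`.
-/
lemma integral_eq_valueFn {β : ℝ} (hβ : β ∈ Ioo (0 : ℝ) 1) {a : Fin N → ℝ} {v : ℝ → ℝ → ℝ}
    (hv : IsValueFunction β quadCost (empiricalMeasure a) v) :
    EqOn (fun y => ∫ q, v y q ∂(empiricalMeasure a)) (valueFn β a) (Ici 0) := by
  intro X hX
  set w : ℝ → ℝ := fun y => ∫ q, v y q ∂(empiricalMeasure a) with hw
  have hwc : ContinuousOn w (Icc 0 X) := by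
    simp only [hw, integral_empiricalMeasure]
    refine ContinuousOn.div_const (continuousOn_finsetSum _ fun i _ => ?_) _
    exact hv.1.comp (f := fun y : ℝ => (y, a i)) (by fun_prop) fun y hy => ⟨hy.1, trivial⟩
  have hd : ContinuousOn (fun y => |w y - valueFn β a y|) (Icc 0 X) :=
    (hwc.sub (continuous_valueFn hβ a).continuousOn).abs
  obtain ⟨x, hx, hmax⟩ := isCompact_Icc.exists_isMaxOn ⟨X, hX, le_rfl⟩ hd
  have hle : |w x - valueFn β a x| ≤ β * |w x - valueFn β a x| := by
    nth_rewrite 1 [← bellmanOp_valueFn hβ a x]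
    simp only [hw, integral_empiricalMeasure]
    have hβ0 := hβ.1.le
    refine abs_average_sub_le (by positivity) fun i => ?_
    refine abs_sub_le_of_isLUB_image (S := Icc 0 x) (hv.2 x hx.1 (a i))
      (isGreatest_objectiveSup_Icc (continuous_valueFn hβ a) x (a i) hx.1).isLUB fun y hy => ?_
    have hy' := hmax (show y ∈ Icc 0 X from ⟨hy.1, hy.2.trans hx.2⟩)
    simp only [mem_ofPred_eq] at hy'
    have : bellmanObjective β quadCost (empiricalMeasure a) v x (a i) y
        - objective β (valueFn β a) x (a i) y = β * (w y - valueFn β a y) := by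
      rw [bellmanObjective_eq]; unfold objective; ring
    rw [this, abs_mul, abs_of_nonneg hβ0]
    simp only [← integral_empiricalMeasure]
    exact mul_le_mul_of_nonneg_left hy' hβ0
  have h0 : |w x - valueFn β a x| = 0 := by
    nlinarith [abs_nonneg (w x - valueFn β a x), hβ.2]
  have := hmax (show X ∈ Icc 0 X from ⟨hX, le_rfl⟩)
  simp only [mem_ofPred_eq, h0] at this
  exact sub_eq_zero.1 (abs_nonpos_iff.1 this)

/-! ### The optimal policy -/

/-- The truncation `max x 0` makes the policy total on `ℝ`, so that its measurability can be stated
without restricting the domain. -/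
lemma exists_isMaxOn_objective {β : ℝ} (hβ : β ∈ Ioo (0 : ℝ) 1) (a : Fin N → ℝ) (x p : ℝ) :
    ∃ y ∈ Icc 0 (max x 0), IsMaxOn (objective β (valueFn β a) (max x 0) p) (Icc 0 (max x 0)) y :=
  isCompact_Icc.exists_isMaxOn ⟨0, by simp⟩
    (continuous_objective (continuous_valueFn hβ a) _ _).continuousOn

open Classical in
/-- The optimal policy for the empirical distribution of `a`. -/
def optPolicy (β : ℝ) (a : Fin N → ℝ) (x p : ℝ) : ℝ :=
  if hβ : β ∈ Ioo (0 : ℝ) 1 then (exists_isMaxOn_objective hβ a x p).choose else 0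

lemma optPolicy_mem {β : ℝ} (hβ : β ∈ Ioo (0 : ℝ) 1) (a : Fin N → ℝ) (x p : ℝ) :
    optPolicy β a x p ∈ Icc 0 (max x 0) := by
  rw [optPolicy, dif_pos hβ]
  exact (exists_isMaxOn_objective hβ a x p).choose_spec.1

lemma isMaxOn_optPolicy {β : ℝ} (hβ : β ∈ Ioo (0 : ℝ) 1) (a : Fin N → ℝ) (x p : ℝ) :
    IsMaxOn (objective β (valueFn β a) (max x 0) p) (Icc 0 (max x 0)) (optPolicy β a x p) := by
  rw [optPolicy, dif_pos hβ]
  exact (exists_isMaxOn_objective hβ a x p).choose_spec.2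

lemma isMaxOn_objective_unique {β : ℝ} (hβ : β ∈ Ioo (0 : ℝ) 1) {a : Fin N → ℝ} {x p z y₁ y₂ : ℝ}
    (h₁ : y₁ ∈ Icc 0 z) (h₂ : y₂ ∈ Icc 0 z)
    (m₁ : IsMaxOn (objective β (valueFn β a) x p) (Icc 0 z) y₁)
    (m₂ : IsMaxOn (objective β (valueFn β a) x p) (Icc 0 z) y₂) : y₁ = y₂ :=
  ((strictConcaveOn_objective hβ.1.le (concaveOn_valueFn hβ a) x p).subset Icc_subset_Ici_self
    (convex_Icc 0 z)).eq_of_isMaxOn m₁ m₂ h₁ h₂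

lemma eq_optPolicy {β : ℝ} (hβ : β ∈ Ioo (0 : ℝ) 1) {a : Fin N → ℝ} {y : ℝ → ℝ → ℝ}
    (hy : IsSDPPolicy β quadCost a y) {x : ℝ} (hx : 0 ≤ x) (p : ℝ) :
    y x p = optPolicy β a x p := by
  obtain ⟨v, hv, h⟩ := hy
  obtain ⟨h1, h2⟩ := h x hx p
  have hm := isMaxOn_optPolicy hβ a x p
  have hp := optPolicy_mem hβ a x p
  rw [max_eq_left hx] at hm hp
  refine isMaxOn_objective_unique hβ h1 hp (fun z hz => ?_) hm
  have := h2 hz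
  have hE := integral_eq_valueFn hβ hv
  simp only [mem_ofPred_eq, bellmanObjective_eq, objective] at this ⊢
  have e1 := hE (show z ∈ Ici 0 from hz.1)
  have e2 := hE (show y x p ∈ Ici 0 from h1.1)
  simp only at e1 e2
  rwa [e1, e2] at this

lemma isSDPPolicy_optPolicy {β : ℝ} (hβ : β ∈ Ioo (0 : ℝ) 1) (a : Fin N → ℝ) :
    IsSDPPolicy β quadCost a (optPolicy β a) := by
  have hW := continuous_valueFn hβ a
  have key : ∀ y, ∫ q, objectiveSup β (valueFn β a) y q y ∂(empiricalMeasure a)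
      = valueFn β a y := by
    intro y
    rw [integral_empiricalMeasure]
    exact bellmanOp_valueFn hβ a y
  refine ⟨fun x p => objectiveSup β (valueFn β a) x p x, ⟨?_, fun x hx p => ?_⟩, fun x hx p => ?_⟩
  · exact (continuous_objectiveSup (X := ℝ × ℝ) (w := fun _ => valueFn β a)
      (hW.comp continuous_snd) continuous_fst continuous_snd continuous_fst).continuousOn
  · rw [bellmanObjective_eq]
    simp only [key]
    exact (isGreatest_objectiveSup_Icc hW x p hx).isLUB
  · rw [bellmanObjective_eq]
    simp only [key]
    have hm := isMaxOn_optPolicy hβ a x p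
    have hp := optPolicy_mem hβ a x p
    rw [max_eq_left hx] at hm hp
    exact ⟨hp, hm⟩

/-- As the maximizer is unique, it lies below `c` exactly when restricting to levels at most `c`
loses nothing. This compares two continuous functions, so sublevel sets of the policy are closed. -/
lemma optPolicy_le_iff {β : ℝ} (hβ : β ∈ Ioo (0 : ℝ) 1) (a : Fin N → ℝ) (x p : ℝ) {c : ℝ}
    (hc : 0 ≤ c) : optPolicy β a x p ≤ c ↔
      objectiveSup β (valueFn β a) (max x 0) p (max x 0)
        ≤ objectiveSup β (valueFn β a) (max x 0) p (min c (max x 0)) := by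
  have hW := continuous_valueFn hβ a
  have hx : 0 ≤ max x 0 := le_max_right _ _
  have hm := isMaxOn_optPolicy hβ a x p
  have hp := optPolicy_mem hβ a x p
  constructor
  · intro h
    obtain ⟨y, hy, hy'⟩ := (isGreatest_objectiveSup_Icc (β := β) hW (max x 0) p hx).1
    rw [← hy']
    exact (hm hy).trans (objective_le_objectiveSup hW _ _ ⟨hp.1, le_min h hp.2⟩)
  · intro h
    obtain ⟨y, hy, hy'⟩ := (isGreatest_objectiveSup_Icc (β := β) hW (max x 0) p
      (le_min hc hx)).1
    have hyx : y ∈ Icc 0 (max x 0) := ⟨hy.1, hy.2.trans (min_le_right _ _)⟩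
    have : y = optPolicy β a x p := by
      refine isMaxOn_objective_unique hβ hyx hp (fun z hz => ?_) hm
      rw [mem_ofPred_eq, hy']
      exact (objective_le_objectiveSup hW _ _ hz).trans h
    rw [← this]
    exact hy.2.trans (min_le_left _ _)

lemma measurable_optPolicy {β : ℝ} (hβ : β ∈ Ioo (0 : ℝ) 1) :
    Measurable fun q : (Fin N → ℝ) × ℝ × ℝ => optPolicy β q.1 q.2.1 q.2.2 := by
  refine measurable_of_Iic fun c => ?_
  rcases lt_or_ge c 0 with hc | hc
  · convert! MeasurableSet.empty
    ext q
    simp only [mem_preimage, mem_Iic, mem_empty_iff_false, iff_false, not_le]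
    exact hc.trans_le (optPolicy_mem hβ _ _ _).1
  · have hcont : ∀ z : (Fin N → ℝ) × ℝ × ℝ → ℝ, Continuous z →
        Continuous fun q : (Fin N → ℝ) × ℝ × ℝ =>
          objectiveSup β (valueFn β q.1) (max q.2.1 0) q.2.2 (z q) := fun z hz =>
      continuous_objectiveSup (w := fun q : (Fin N → ℝ) × ℝ × ℝ => valueFn β q.1)
        ((continuous_valueFn_prod hβ).comp
          (f := fun r : ((Fin N → ℝ) × ℝ × ℝ) × ℝ => (r.1.1, r.2)) (by fun_prop))
        (by fun_prop) (by fun_prop) hz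
    convert! (isClosed_le (hcont (fun q => max q.2.1 0) (by fun_prop))
      (hcont (fun q => min c (max q.2.1 0)) (by fun_prop))).measurableSet
    ext q
    simp only [mem_preimage, mem_Iic, mem_ofPred_eq]
    exact optPolicy_le_iff hβ q.1 q.2.1 q.2.2 hc

end Uniqueness

/-! ### Qualitative behaviour of the optimal policy -/

section Behaviour

variable {N : ℕ} {β : ℝ} {a : Fin N → ℝ}

lemma valueFn_zero (hβ : β ∈ Ioo (0 : ℝ) 1) (a : Fin N → ℝ) : valueFn β a 0 = 0 := by
  have := dist_valueIter_valueFn_le hβ a 0 0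
  simpa [valueBound, valueIter, eq_comm] using this

/-- No unit is ever sold above `M`, and storage and discounting only reduce the value. -/
lemma valueFn_le (hβ : β ∈ Ioo (0 : ℝ) 1) {M : ℝ} (hM : 0 ≤ M) (ha : ∀ i, a i ≤ M) {x : ℝ}
    (hx : 0 ≤ x) : valueFn β a x ≤ M * x := by
  have h : ∀ n, ∀ x, 0 ≤ x → valueIter β a n x ≤ M * x := by
    intro n
    induction n with
    | zero => intro x hx; simpa [valueIter] using mul_nonneg hM hx
    | succ n ih =>
      intro x hx
      have hle : ∀ i, objectiveSup β (valueIter β a n) x (a i) x ≤ M * x := by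
        intro i
        obtain ⟨y, hy, hy'⟩ := (isGreatest_objectiveSup_Icc (β := β)
          (continuous_valueIter β a n) x (a i) hx).1
        rw [← hy', objective, quadCost]
        have h1 : a i * (x - y) ≤ M * (x - y) :=
          mul_le_mul_of_nonneg_right (ha i) (by linarith [hy.2])
        have h2 : β * valueIter β a n y ≤ β * (M * y) :=
          mul_le_mul_of_nonneg_left (ih y hy.1) hβ.1.le
        have h3 : β * (M * y) ≤ M * y :=
          mul_le_of_le_one_left (mul_nonneg hM hy.1) hβ.2.le
        nlinarith [sq_nonneg y]
      rcases Nat.eq_zero_or_pos N with rfl | hN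
      · simpa [valueIter, bellmanOp] using mul_nonneg hM hx
      have hN' : (0 : ℝ) < N := by exact_mod_cast hN
      rw [valueIter, bellmanOp, div_le_iff₀ hN']
      calc ∑ i, objectiveSup β (valueIter β a n) x (a i) x ≤ ∑ _i : Fin N, M * x :=
            Finset.sum_le_sum fun i _ => hle i
        _ = M * x * N := by simp [mul_comm]
  exact le_of_tendsto' (tendsto_valueIter hβ a x) fun n => h n x hx

/-- Everything is sold when the price is at least as large as all sampled prices. -/
lemma optPolicy_eq_zero (hβ : β ∈ Ioo (0 : ℝ) 1) {M : ℝ} (hM : 0 ≤ M) (ha : ∀ i, a i ≤ M)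
    (x : ℝ) {p : ℝ} (hp : M ≤ p) : optPolicy β a x p = 0 := by
  have hmem := optPolicy_mem hβ a x p
  have hm := isMaxOn_optPolicy hβ a x p (show 0 ∈ Icc 0 (max x 0) by simp)
  set y := optPolicy β a x p
  simp only [mem_ofPred_eq, objective, quadCost, valueFn_zero hβ] at hm
  have h1 := mul_le_mul_of_nonneg_left (valueFn_le hβ hM ha hmem.1) hβ.1.le
  have h2 : β * (M * y) ≤ M * y := mul_le_of_le_one_left (mul_nonneg hM hmem.1) hβ.2.le
  have h3 : M * y ≤ p * y := mul_le_mul_of_nonneg_right hp hmem.1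
  nlinarith

/-- Holding the inventory until the price `a i` recurs bounds the value function from below. -/
lemma le_valueFn (hβ : β ∈ Ioo (0 : ℝ) 1) (i : Fin N) {x : ℝ} (hx : 0 ≤ x) :
    a i * x - (N - 1) * (x ^ 2 / 2) ≤ valueFn β a x * (N - (N - 1) * β) := by
  have hW := continuous_valueFn hβ a
  have hN : (0 : ℝ) < N := by exact_mod_cast i.pos
  have hfix := bellmanOp_valueFn hβ a x
  rw [bellmanOp, div_eq_iff hN.ne', ← Finset.add_sum_erase _ _ (Finset.mem_univ i)] at hfix
  -- The fixed point equation is bounded below by selling everything in scenario `i` and keeping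
  -- everything in the other `N - 1`; the result is linear in `valueFn β a x`.
  have h1 : a i * x ≤ objectiveSup β (valueFn β a) x (a i) x := by
    have := objective_le_objectiveSup (β := β) hW x (a i) (y := 0) (z := x) ⟨le_rfl, hx⟩
    simpa [objective, quadCost, valueFn_zero hβ] using this
  have h2 : ∀ j, β * valueFn β a x - x ^ 2 / 2 ≤ objectiveSup β (valueFn β a) x (a j) x := by
    intro j
    have := objective_le_objectiveSup (β := β) hW x (a j) (y := x) (z := x) ⟨hx, le_rfl⟩
    simp only [objective, quadCost, sub_self, mul_zero] at this
    linarith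
  have h3 := Finset.sum_le_sum (s := Finset.univ.erase i) fun j _ => h2 j
  rw [Finset.sum_const, Finset.card_erase_of_mem (Finset.mem_univ i), Finset.card_univ,
    Fintype.card_fin, nsmul_eq_mul, Nat.cast_pred i.pos] at h3
  linarith

/-- When the discount factor is close to one, a fixed amount of inventory is kept at all prices that
fall short of the largest sampled price by at least one. -/
lemma le_optPolicy (hβ : β ∈ Ioo (0 : ℝ) 1) {i : Fin N} (ha : ∀ j, a j ≤ a i) {K : ℝ}
    (h1 : 1 ≤ a i) (hK : a i ≤ K) (hβK : (1 - β) * K ≤ 1 / (4 * N)) {x p : ℝ}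
    (hx : 1 / (4 * N) ≤ x) (hp : p ≤ a i - 1) : 1 / (4 * N) ≤ optPolicy β a x p := by
  have hN : (1 : ℝ) ≤ N := by exact_mod_cast i.pos
  have hN0 : (0 : ℝ) < N := by linarith
  have hc0 : (0 : ℝ) < 1 / (4 * N) := by positivity
  have hx0 : 0 ≤ x := hc0.le.trans hx
  set M := a i with hMdef
  have hmem := optPolicy_mem hβ a x p
  have hm := isMaxOn_optPolicy hβ a x p
  rw [max_eq_left hx0] at hmem hm
  set y := optPolicy β a x p
  set c : ℝ := 1 / (4 * N) with hc
  by_contra! hlt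
  set f := objective β (valueFn β a) x p with hf
  -- The objective lies below a line of slope `M - p ≥ 1`.
  have hW : ∀ z, 0 ≤ z → f z ≤ p * x + (M - p) * z := by
    intro z hz
    have h1' := mul_le_mul_of_nonneg_left (valueFn_le hβ (by linarith) ha hz) hβ.1.le
    have h2' : β * (M * z) ≤ M * z :=
      mul_le_of_le_one_left (mul_nonneg (by linarith) hz) hβ.2.le
    rw [hf, objective, quadCost]
    nlinarith [sq_nonneg z]
  -- The level `4 * c = 1 / N` maximizes `z - N * z ^ 2 / 2`, the undiscounted gain from holding at
  -- margin one. Storage costs `2 * c` and discounting at most `c`, so the value is at least `(M -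
  -- p) * (4 * c) - 3 * c`, hence at least `(M - p) * c`.
  have hlow : p * x + (M - p) * c ≤ f (4 * c) := by
    have hcN : c * N = 1 / 4 := by rw [hc]; field_simp
    have hle := le_valueFn (a := a) hβ i (x := 4 * c) (by positivity)
    rw [← hMdef] at hle
    set w := valueFn β a (4 * c) with hw
    have hε : 0 < 1 - β := by linarith [hβ.2]
    -- the discounted value of holding is at least the undiscounted one minus `N (1 - β) M`
    set B := M * (4 * c) - (N - 1) * ((4 * c) ^ 2 / 2) with hB
    have hcle : c ≤ 1 / 4 := by nlinarith
    have hB0 : 0 ≤ B := by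
      have : (N - 1) * ((4 * c) ^ 2 / 2) = 8 * (c * N) * c - 8 * c ^ 2 := by ring
      rw [hB, this, hcN]
      nlinarith
    have hw0 : 0 ≤ w := by
      by_contra! hneg
      have : 0 < (N : ℝ) - (N - 1) * β := by nlinarith [hβ.2]
      nlinarith
    have hBM : B ≤ M * (4 * c) := by rw [hB]; nlinarith [sq_nonneg (4 * c)]
    have hkey : B - N * (1 - β) * B ≤ β * w := by
      have hD : (N : ℝ) - (N - 1) * β = 1 + (N - 1) * (1 - β) := by ring
      rw [hD] at hle
      rcases le_or_gt (1 - N * (1 - β)) 0 with h | h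
      · have : B * (1 - N * (1 - β)) ≤ 0 := mul_nonpos_of_nonneg_of_nonpos hB0 h
        nlinarith [mul_nonneg hβ.1.le hw0]
      · have e1 := mul_le_mul_of_nonneg_left hle h.le
        -- With `ε = 1 - β` the product equals `1 - ε - N * (N - 1) * ε ^ 2`.
        have e2 : (1 - N * (1 - β)) * (1 + (N - 1) * (1 - β)) ≤ β := by
          nlinarith [mul_nonneg (mul_nonneg hN0.le (sub_nonneg.2 hN)) (sq_nonneg (1 - β))]
        nlinarith [mul_le_mul_of_nonneg_right e2 hw0]
    have hNB : N * (1 - β) * B ≤ c := by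
      have e1 : N * (1 - β) * B ≤ N * (1 - β) * (M * (4 * c)) :=
        mul_le_mul_of_nonneg_left hBM (by positivity)
      have e2 : N * (1 - β) * (M * (4 * c)) = (1 - β) * M * (4 * (c * N)) := by ring
      rw [e2, hcN] at e1
      have e3 : (1 - β) * M ≤ (1 - β) * K := mul_le_mul_of_nonneg_left hK hε.le
      linarith
    have hquad : (N : ℝ) * ((4 * c) ^ 2 / 2) = 2 * c := by
      have : (N : ℝ) * ((4 * c) ^ 2 / 2) = 8 * (c * N) * c := by ring
      rw [this, hcN]; ring
    rw [hf, objective, quadCost]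
    nlinarith
  have hylt : f y < f (4 * c) := by
    have := hW y hmem.1
    nlinarith
  have hmax : f c ≤ f y := hm ⟨hc0.le, hx⟩
  -- The level `4 * c` may exceed `x` and be infeasible. Strict concavity carries its advantage over
  -- `y` down to `c`, which is feasible, contradicting the maximality of `y`.
  have hstrict := (strictConcaveOn_objective hβ.1.le (concaveOn_valueFn hβ a) x p).lt_on_openSegment
    (x := y) (y := 4 * c) hmem.1 (by positivity : (0 : ℝ) ≤ 4 * c) (by linarith)
    (z := c) (by rw [openSegment_eq_Ioo (by linarith)]; exact ⟨hlt, by linarith⟩)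
  rw [← hf, min_eq_left hylt.le] at hstrict
  linarith

end Behaviour

/-! ### The exponential distribution -/

lemma measurable_gammaPDF (a r : ℝ) : Measurable (gammaPDF a r) :=
  (measurable_gammaPDFReal a r).ennreal_ofReal

lemma toReal_gammaPDF_one_one (x : ℝ) :
    (gammaPDF 1 1 x).toReal = (Ici (0 : ℝ)).indicator (fun x => Real.exp (-x)) x := by
  have h := exponentialPDF_eq 1 x
  rw [show gammaPDF 1 1 x = exponentialPDF 1 x from rfl, h, ENNReal.toReal_ofReal]
  · simp [indicator]
  · split_ifs <;> positivity

lemma integral_expMeasure_one (f : ℝ → ℝ) :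
    ∫ x, f x ∂(expMeasure 1) = ∫ x in Ioi 0, Real.exp (-x) * f x := by
  rw [expMeasure, gammaMeasure, integral_withDensity_eq_integral_toReal_smul
    (measurable_gammaPDF 1 1) (by simp [gammaPDF]), ← integral_Ici_eq_integral_Ioi,
    ← integral_indicator measurableSet_Ici]
  refine integral_congr_ae (ae_of_all _ fun x => ?_)
  simp only [toReal_gammaPDF_one_one, smul_eq_mul, indicator]
  split_ifs <;> simp

lemma integrable_expMeasure_one_iff (f : ℝ → ℝ) :
    Integrable f (expMeasure 1) ↔ IntegrableOn (fun x => Real.exp (-x) * f x) (Ioi 0) := by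
  rw [expMeasure, gammaMeasure, integrable_withDensity_iff_integrable_smul'
    (measurable_gammaPDF 1 1) (by simp [gammaPDF]), ← integrableOn_Ici_iff_integrableOn_Ioi,
    ← integrable_indicator_iff measurableSet_Ici]
  refine integrable_congr (ae_of_all _ fun x => ?_)
  simp only [toReal_gammaPDF_one_one, smul_eq_mul, indicator]
  split_ifs <;> simp

lemma integrable_exp_mul_expMeasure {c : ℝ} (hc : c < 1) :
    Integrable (fun x => Real.exp (c * x)) (expMeasure 1) := by
  rw [integrable_expMeasure_one_iff]
  refine (integrableOn_exp_mul_Ioi (a := c - 1) (by linarith) 0).congr_fun (fun x _ => ?_)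
    measurableSet_Ioi
  simp only [← Real.exp_add]; ring_nf

lemma integral_exp_half_expMeasure : ∫ x, Real.exp (x / 2) ∂(expMeasure 1) = 2 := by
  have h := integral_exp_mul_Ioi (a := -(1 / 2)) (by norm_num) 0
  rw [integral_expMeasure_one]
  calc _ = ∫ x in Ioi (0 : ℝ), Real.exp (-(1 / 2) * x) :=
        integral_congr_ae (ae_of_all _ fun x => by simp only [← Real.exp_add]; ring_nf)
    _ = 2 := by rw [h]; norm_num

lemma integrable_exp_half_expMeasure : Integrable (fun x => Real.exp (x / 2)) (expMeasure 1) := by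
  simpa [div_eq_inv_mul] using integrable_exp_mul_expMeasure (c := 1 / 2) (by norm_num)

lemma ae_nonneg_expMeasure : ∀ᵐ x ∂(expMeasure 1), 0 ≤ x := by
  rw [expMeasure, gammaMeasure, ae_withDensity_iff (measurable_gammaPDF 1 1)]
  refine ae_of_all _ fun x hx => ?_
  by_contra! h
  exact hx (gammaPDF_of_neg h)

lemma measureReal_Iic_expMeasure {m : ℝ} (hm : 0 ≤ m) :
    (expMeasure 1).real (Iic m) = 1 - Real.exp (-m) := by
  rw [← cdf_eq_real, cdf_expMeasure_eq one_pos, if_pos hm, one_mul]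

/-- The density cancels the exponential; the linear growth in `K` is the source of the divergence.
-/
lemma integral_indicator_Icc_exp {K : ℝ} (hK : 2 ≤ K) :
    ∫ x, (Icc 2 K).indicator Real.exp x ∂(expMeasure 1) = K - 2 := by
  rw [integral_expMeasure_one]
  have : ∀ x, Real.exp (-x) * (Icc 2 K).indicator Real.exp x
      = (Icc 2 K).indicator (fun _ => (1 : ℝ)) x := by
    intro x
    simp only [indicator]
    split_ifs
    · rw [← Real.exp_add]; simp
    · simp
  simp only [this]
  rw [integral_indicator measurableSet_Icc, Measure.restrict_restrict measurableSet_Icc,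
    inter_eq_left.2 (show Icc 2 K ⊆ Ioi (0 : ℝ) from
      fun x hx => lt_of_lt_of_le (by norm_num) hx.1)]
  simp [hK]

lemma integrable_abs_expMeasure : Integrable (fun x : ℝ => |x|) (expMeasure 1) := by
  refine (integrable_exp_half_expMeasure.const_mul 2).mono' (by fun_prop) ?_
  filter_upwards [ae_nonneg_expMeasure] with x hx
  rw [Real.norm_eq_abs, abs_abs, abs_of_nonneg hx]
  linarith [Real.add_one_le_exp (x / 2)]

lemma max_sub_zero_le (m x : ℝ) :
    max (x - m) 0 ≤ 2 * Real.exp (-m / 2) * Real.exp (x / 2) := by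
  rw [mul_assoc, ← Real.exp_add]
  refine max_le ?_ (by positivity)
  linarith [Real.add_one_le_exp (-m / 2 + x / 2)]

lemma integrable_max_sub_zero (m : ℝ) : Integrable (fun x => max (x - m) 0) (expMeasure 1) := by
  refine (integrable_exp_half_expMeasure.const_mul (2 * Real.exp (-m / 2))).mono'
    (by fun_prop) (ae_of_all _ fun x => ?_)
  rw [Real.norm_of_nonneg (le_max_right _ _)]
  exact max_sub_zero_le m x

lemma integral_max_sub_zero_le (m : ℝ) :
    ∫ x, max (x - m) 0 ∂(expMeasure 1) ≤ 4 * Real.exp (-m / 2) := by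
  calc _ ≤ ∫ x, 2 * Real.exp (-m / 2) * Real.exp (x / 2) ∂(expMeasure 1) :=
        integral_mono (integrable_max_sub_zero m)
          (integrable_exp_half_expMeasure.const_mul _) (max_sub_zero_le m)
    _ = _ := by rw [integral_const_mul, integral_exp_half_expMeasure]; ring

/-! ### Independent price paths -/

/-- The law of an i.i.d. sequence of `Exponential(1)` prices. -/
abbrev pathMeasure : Measure (ℕ → ℝ) := Measure.infinitePi fun _ : ℕ => expMeasure 1

lemma integral_prod_range_pathMeasure (n : ℕ) {f : ℕ → ℝ → ℝ} (hf : ∀ i, Measurable (f i)) :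
    ∫ p, ∏ i ∈ Finset.range n, f i (p i) ∂pathMeasure
      = ∏ i ∈ Finset.range n, ∫ x, f i x ∂(expMeasure 1) := by
  have h := integral_restrict_infinitePi (μ := fun _ : ℕ => expMeasure 1) (s := Finset.range n)
    (f := fun p => ∏ i : Finset.range n, f i (p i)) (by
      refine Measurable.aestronglyMeasurable ?_
      exact Finset.measurable_prod _ fun i _ => (hf i).comp (measurable_pi_apply i))
  rw [integral_fintype_prod_eq_prod (fun i : Finset.range n => f i)] at h
  rw [← Finset.prod_coe_sort (Finset.range n) (fun i => ∫ x, f i x ∂(expMeasure 1)), ← h]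
  refine integral_congr_ae (ae_of_all _ fun p => ?_)
  exact (Finset.prod_coe_sort (Finset.range n) fun i => f i (p i)).symm

/-- The indicator of the event that the first `t` prices are at most `m`. -/
def lowPrices (m : ℝ) (t : ℕ) (p : ℕ → ℝ) : ℝ :=
  ∏ i ∈ Finset.range t, (Iic m).indicator 1 (p i)

lemma lowPrices_succ (m : ℝ) (t : ℕ) (p : ℕ → ℝ) :
    lowPrices m (t + 1) p = lowPrices m t p * (Iic m).indicator 1 (p t) :=
  Finset.prod_range_succ _ _

lemma lowPrices_eq_zero_or_one (m : ℝ) (t : ℕ) (p : ℕ → ℝ) :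
    lowPrices m t p = 0 ∨ lowPrices m t p = 1 := by
  induction t with
  | zero => simp [lowPrices]
  | succ t ih =>
    rw [lowPrices_succ]
    by_cases h : p t ∈ Iic m
    · simpa [h] using ih
    · simp [h]

lemma lowPrices_nonneg (m : ℝ) (t : ℕ) (p : ℕ → ℝ) : 0 ≤ lowPrices m t p := by
  rcases lowPrices_eq_zero_or_one m t p with h | h <;> simp [h]

lemma lowPrices_le_one (m : ℝ) (t : ℕ) (p : ℕ → ℝ) : lowPrices m t p ≤ 1 := by
  rcases lowPrices_eq_zero_or_one m t p with h | h <;> simp [h]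

lemma measurable_lowPrices (m : ℝ) (t : ℕ) : Measurable (lowPrices m t) := by
  refine Finset.measurable_prod _ fun i _ => ?_
  exact (measurable_one.indicator measurableSet_Iic).comp (measurable_pi_apply i)

lemma integrable_comp_eval_pathMeasure {h : ℝ → ℝ} (hi : Integrable h (expMeasure 1)) (t : ℕ) :
    Integrable (fun p => h (p t)) pathMeasure :=
  (measurePreserving_eval_infinitePi (fun _ : ℕ => expMeasure 1) t).integrable_comp_of_integrable hi

lemma integrable_lowPrices_mul {h : ℝ → ℝ} (hi : Integrable h (expMeasure 1)) (m : ℝ) (t : ℕ) :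
    Integrable (fun p => lowPrices m t p * h (p t)) pathMeasure := by
  refine (integrable_comp_eval_pathMeasure hi t).bdd_mul (c := 1)
    (measurable_lowPrices m t).aestronglyMeasurable (ae_of_all _ fun p => ?_)
  rw [Real.norm_of_nonneg (lowPrices_nonneg m t p)]
  exact lowPrices_le_one m t p

/-- The factor `lowPrices m t` depends only on prices before time `t`, hence is independent of `p
t`. -/
lemma integral_lowPrices_mul {h : ℝ → ℝ} (hm : Measurable h) (m : ℝ) (t : ℕ) :
    ∫ p, lowPrices m t p * h (p t) ∂pathMeasure
      = (expMeasure 1).real (Iic m) ^ t * ∫ x, h x ∂(expMeasure 1) := by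
  set f : ℕ → ℝ → ℝ := fun i => if i < t then (Iic m).indicator 1 else h with hf
  have hfm : ∀ i, Measurable (f i) := by
    intro i
    simp only [hf]
    split_ifs
    · exact measurable_one.indicator measurableSet_Iic
    · exact hm
  have hlt : ∀ i ∈ Finset.range t, f i = (Iic m).indicator 1 := fun i hi => by
    simp only [hf, Finset.mem_range.1 hi, if_true]
  have ht : f t = h := by simp [hf]
  have key := integral_prod_range_pathMeasure (t + 1) hfm
  simp only [Finset.prod_range_succ, ht] at key
  rw [Finset.prod_congr rfl fun i hi => by rw [hlt i hi],
    integral_indicator_one measurableSet_Iic, Finset.prod_const, Finset.card_range] at key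
  rw [← key]
  refine integral_congr_ae (ae_of_all _ fun p => ?_)
  simp only [lowPrices]
  rw [Finset.prod_congr rfl fun i hi => by rw [← hlt i hi]]

lemma integral_lowPrices (m : ℝ) (t : ℕ) :
    ∫ p, lowPrices m t p ∂pathMeasure = (expMeasure 1).real (Iic m) ^ t := by
  simpa using integral_lowPrices_mul (h := fun _ => 1) measurable_const m t

lemma integrable_lowPrices (m : ℝ) (t : ℕ) : Integrable (lowPrices m t) pathMeasure := by
  simpa using integrable_lowPrices_mul (h := fun _ => 1) (integrable_const _) m t

/-! ### Out-of-sample performance of measurable policies -/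

/-- A policy never buys and never sells more than is in stock. -/
def IsFeasible (y : ℝ → ℝ → ℝ) : Prop := ∀ x, 0 ≤ x → ∀ p, y x p ∈ Icc 0 x

section Inventory

variable {y : ℝ → ℝ → ℝ}

lemma inventory_nonneg (hy : IsFeasible y) (p : ℕ → ℝ) (t : ℕ) : 0 ≤ inventory y 1 p t := by
  induction t with
  | zero => simp [inventory]
  | succ t ih => exact (hy _ ih _).1

lemma inventory_succ_le (hy : IsFeasible y) (p : ℕ → ℝ) (t : ℕ) :
    inventory y 1 p (t + 1) ≤ inventory y 1 p t :=
  (hy _ (inventory_nonneg hy p t) _).2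

lemma inventory_le_one (hy : IsFeasible y) (p : ℕ → ℝ) (t : ℕ) : inventory y 1 p t ≤ 1 := by
  induction t with
  | zero => simp [inventory]
  | succ t ih => exact (inventory_succ_le hy p t).trans ih

/-- A single price above `m` empties the stock for good. -/
lemma inventory_le_lowPrices (hy : IsFeasible y) {m : ℝ}
    (hm : ∀ x, 0 ≤ x → ∀ p, m ≤ p → y x p = 0) (p : ℕ → ℝ) (t : ℕ) :
    inventory y 1 p t ≤ lowPrices m t p := by
  induction t with
  | zero => simp [inventory, lowPrices]
  | succ t ih =>
    rw [lowPrices_succ]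
    by_cases h : p t ≤ m
    · simpa [h] using (inventory_succ_le hy p t).trans ih
    · rw [inventory, hm _ (inventory_nonneg hy p t) _ (le_of_not_ge h)]
      simp [h]

lemma lowPrices_le_inventory (hy : IsFeasible y) {c m : ℝ} (hc1 : c ≤ 1)
    (hm : ∀ x, c ≤ x → ∀ p ≤ m, c ≤ y x p) (p : ℕ → ℝ) (t : ℕ) :
    c * lowPrices m t p ≤ inventory y 1 p t := by
  induction t with
  | zero => simpa [inventory, lowPrices] using hc1
  | succ t ih =>
    rcases lowPrices_eq_zero_or_one m (t + 1) p with h | h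
    · simpa [h] using inventory_nonneg hy p (t + 1)
    · rw [lowPrices_succ] at h
      have hp : p t ≤ m := by
        by_contra hlt
        simp [hlt] at h
      have h1 : lowPrices m t p = 1 := by simpa [hp] using h
      rw [lowPrices_succ, h, mul_one]
      rw [h1, mul_one] at ih
      exact hm _ ih _ hp

lemma abs_stageReward_le (hy : IsFeasible y) {β : ℝ} (hβ : β ∈ Ioo (0 : ℝ) 1) (p : ℕ → ℝ) (t : ℕ) :
    |stageReward β quadCost y 1 p t| ≤ β ^ t * (inventory y 1 p t * (|p t| + 1 / 2)) := by
  have h0 := inventory_nonneg hy p t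
  have h1 := inventory_nonneg hy p (t + 1)
  have h2 := inventory_succ_le hy p t
  have h3 := inventory_le_one hy p t
  have hβt : 0 ≤ β ^ t := pow_nonneg hβ.1.le t
  rw [stageReward, abs_mul, abs_of_nonneg hβt]
  refine mul_le_mul_of_nonneg_left ?_ hβt
  set u := inventory y 1 p t
  set z := inventory y 1 p (t + 1)
  have e1 : |p t * (u - z)| ≤ |p t| * u := by
    rw [abs_mul, abs_of_nonneg (sub_nonneg.2 h2)]
    exact mul_le_mul_of_nonneg_left (by linarith) (abs_nonneg _)
  have e2 : |quadCost z| ≤ u / 2 := by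
    rw [quadCost, abs_of_nonneg (by positivity)]
    nlinarith
  calc _ ≤ |p t * (u - z)| + |quadCost z| := abs_sub _ _
    _ ≤ _ := by linarith

end Inventory

section Measurability

variable {S : Type*} [MeasurableSpace S] {y : S → ℝ → ℝ → ℝ}

lemma measurable_inventory (hy : Measurable fun q : S × ℝ × ℝ => y q.1 q.2.1 q.2.2) (t : ℕ) :
    Measurable fun q : S × (ℕ → ℝ) => inventory (y q.1) 1 q.2 t := by
  induction t with
  | zero => exact measurable_const
  | succ t ih =>
    exact hy.comp (measurable_fst.prodMk
      (ih.prodMk ((measurable_pi_apply t).comp measurable_snd)))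

lemma measurable_stageReward (hy : Measurable fun q : S × ℝ × ℝ => y q.1 q.2.1 q.2.2) (β : ℝ)
    (t : ℕ) : Measurable fun q : S × (ℕ → ℝ) => stageReward β quadCost (y q.1) 1 q.2 t := by
  have h1 := measurable_inventory hy t
  have h2 := measurable_inventory hy (t + 1)
  have h3 := continuous_quadCost.measurable.comp h2
  have h4 : Measurable fun q : S × (ℕ → ℝ) => q.2 t := (measurable_pi_apply t).comp measurable_snd
  unfold stageReward
  exact measurable_const.mul ((h4.mul (h1.sub h2)).sub h3)

end Measurability

/-- The expectation of `|p| + 1 / 2`, which bounds the expected size of a stage reward. -/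
def stageBound : ℝ := ∫ x, (|x| + 1 / 2) ∂(expMeasure 1)

lemma integrable_abs_add_half : Integrable (fun x : ℝ => |x| + 1 / 2) (expMeasure 1) :=
  integrable_abs_expMeasure.add (integrable_const _)

section Performance

variable {y : ℝ → ℝ → ℝ} {β : ℝ}

lemma measurable_inventory_path (hm : Measurable fun q : ℝ × ℝ => y q.1 q.2) (t : ℕ) :
    Measurable fun p : ℕ → ℝ => inventory y 1 p t :=
  (measurable_inventory (S := Unit) (y := fun _ => y) (hm.comp measurable_snd) t).comp
    (measurable_prodMk_left (x := ()))

lemma measurable_stageReward_path (hm : Measurable fun q : ℝ × ℝ => y q.1 q.2) (β : ℝ) (t : ℕ) :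
    Measurable fun p : ℕ → ℝ => stageReward β quadCost y 1 p t :=
  (measurable_stageReward (S := Unit) (y := fun _ => y) (hm.comp measurable_snd) β t).comp
    (measurable_prodMk_left (x := ()))

lemma integrable_inventory_pow (hy : IsFeasible y) (hm : Measurable fun q : ℝ × ℝ => y q.1 q.2)
    (t k : ℕ) : Integrable (fun p => inventory y 1 p t ^ k) pathMeasure := by
  refine (integrable_const (1 : ℝ)).mono'
    ((measurable_inventory_path hm t).pow_const k).aestronglyMeasurable (ae_of_all _ fun p => ?_)
  have h0 := inventory_nonneg hy p t
  rw [Real.norm_of_nonneg (by positivity)]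
  exact pow_le_one₀ h0 (inventory_le_one hy p t)

lemma norm_stageReward_le (hy : IsFeasible y) (hβ : β ∈ Ioo (0 : ℝ) 1) (p : ℕ → ℝ) (t : ℕ) :
    ‖stageReward β quadCost y 1 p t‖ ≤ β ^ t * (|p t| + 1 / 2) := by
  refine (abs_stageReward_le hy hβ p t).trans ?_
  have := hβ.1
  gcongr
  exact mul_le_of_le_one_left (by positivity) (inventory_le_one hy p t)

lemma integrable_stageReward (hy : IsFeasible y) (hm : Measurable fun q : ℝ × ℝ => y q.1 q.2)
    (hβ : β ∈ Ioo (0 : ℝ) 1) (t : ℕ) :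
    Integrable (fun p => stageReward β quadCost y 1 p t) pathMeasure :=
  ((integrable_comp_eval_pathMeasure integrable_abs_add_half t).const_mul (β ^ t)).mono'
    (measurable_stageReward_path hm β t).aestronglyMeasurable
    (ae_of_all _ fun p => norm_stageReward_le hy hβ p t)

lemma integral_norm_stageReward_le (hy : IsFeasible y)
    (hm : Measurable fun q : ℝ × ℝ => y q.1 q.2) (hβ : β ∈ Ioo (0 : ℝ) 1) (t : ℕ) :
    ∫ p, ‖stageReward β quadCost y 1 p t‖ ∂pathMeasure ≤ β ^ t * stageBound := by
  have h := integral_mono (integrable_stageReward hy hm hβ t).norm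
    ((integrable_comp_eval_pathMeasure integrable_abs_add_half t).const_mul (β ^ t))
    fun p => norm_stageReward_le hy hβ p t
  refine h.trans_eq ?_
  rw [integral_const_mul, stageBound]
  congr 1
  have := (measurePreserving_eval_infinitePi (fun _ : ℕ => expMeasure 1) t)
  rw [← this.map_eq, integral_map this.measurable.aemeasurable (by fun_prop)]

lemma summable_integral_norm_stageReward (hy : IsFeasible y)
    (hm : Measurable fun q : ℝ × ℝ => y q.1 q.2) (hβ : β ∈ Ioo (0 : ℝ) 1) :
    Summable fun t => ∫ p, ‖stageReward β quadCost y 1 p t‖ ∂pathMeasure :=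
  Summable.of_nonneg_of_le (fun _ => integral_nonneg fun _ => norm_nonneg _)
    (integral_norm_stageReward_le hy hm hβ)
    ((summable_geometric_of_lt_one hβ.1.le hβ.2).mul_right _)

lemma hasSum_performance (hy : IsFeasible y) (hm : Measurable fun q : ℝ × ℝ => y q.1 q.2)
    (hβ : β ∈ Ioo (0 : ℝ) 1) :
    HasSum (fun t => ∫ p, stageReward β quadCost y 1 p t ∂pathMeasure)
      (performance (expMeasure 1) β quadCost y 1) :=
  hasSum_integral_of_summable_integral_norm (integrable_stageReward hy hm hβ)
    (summable_integral_norm_stageReward hy hm hβ)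

/-- Tonelli: the integral of the sum of absolute values is finite. -/
lemma ae_summable_and_integrable_tsum {α : Type*} [MeasurableSpace α] {μ : Measure α}
    {F : ℕ → α → ℝ} (hF : ∀ t, Integrable (F t) μ)
    (hs : Summable fun t => ∫ a, ‖F t a‖ ∂μ) :
    (∀ᵐ a ∂μ, Summable fun t => F t a) ∧ Integrable (fun a => ∑' t, F t a) μ := by
  have hfin : ∫⁻ a, ∑' t, ‖F t a‖ₑ ∂μ ≠ ∞ := by
    rw [lintegral_tsum fun t => (hF t).1.enorm]
    have : ∀ t, ∫⁻ a, ‖F t a‖ₑ ∂μ = ENNReal.ofReal (∫ a, ‖F t a‖ ∂μ) := fun t =>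
      (ofReal_integral_norm_eq_lintegral_enorm (hF t)).symm
    simp only [this]
    exact hs.tsum_ofReal_ne_top
  have hae : ∀ᵐ a ∂μ, Summable fun t => F t a := by
    filter_upwards [ae_lt_top' (AEMeasurable.tsum fun t => (hF t).1.enorm) hfin] with a ha
    refine Summable.of_norm ?_
    simp only [enorm_eq_nnnorm] at ha
    exact NNReal.summable_coe.2 (ENNReal.tsum_coe_ne_top_iff_summable.1 ha.ne)
  refine ⟨hae, ?_, ?_⟩
  · refine aestronglyMeasurable_of_tendsto_ae atTop
      (f := fun n a => ∑ t ∈ Finset.range n, F t a)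
      (fun n => Finset.aestronglyMeasurable_fun_sum _ fun t _ => (hF t).1) ?_
    filter_upwards [hae] with a ha using ha.hasSum.tendsto_sum_nat
  · exact (lintegral_mono fun a => enorm_tsum_le_tsum_enorm).trans_lt hfin.lt_top

/-- If everything is sold at prices above `m`, the expected time to sell is at most `exp m`. -/
lemma abs_performance_le (hy : IsFeasible y) (hm : Measurable fun q : ℝ × ℝ => y q.1 q.2)
    (hβ : β ∈ Ioo (0 : ℝ) 1) {m : ℝ} (hm0 : 0 ≤ m)
    (hsell : ∀ x, 0 ≤ x → ∀ p, m ≤ p → y x p = 0) :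
    |performance (expMeasure 1) β quadCost y 1| ≤ stageBound * Real.exp m := by
  have hr : (expMeasure 1).real (Iic m) = 1 - Real.exp (-m) := measureReal_Iic_expMeasure hm0
  have hr0 : 0 ≤ (expMeasure 1).real (Iic m) := measureReal_nonneg
  have hr1 : (expMeasure 1).real (Iic m) < 1 := by rw [hr]; linarith [Real.exp_pos (-m)]
  have hsum := (hasSum_geometric_of_lt_one hr0 hr1).mul_right stageBound
  have hval : (1 - (expMeasure 1).real (Iic m))⁻¹ * stageBound = stageBound * Real.exp m := by
    rw [hr, sub_sub_cancel, Real.exp_neg, inv_inv, mul_comm]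
  rw [hval] at hsum
  rw [← (hasSum_performance hy hm hβ).tsum_eq, ← Real.norm_eq_abs]
  refine tsum_of_norm_bounded hsum fun t => ?_
  refine (norm_integral_le_integral_norm fun p => stageReward β quadCost y 1 p t).trans ?_
  have h := integral_mono (integrable_stageReward hy hm hβ t).norm
    (integrable_lowPrices_mul integrable_abs_add_half m t) (fun p => by
      refine (abs_stageReward_le hy hβ p t).trans ?_
      have h1 := inventory_le_lowPrices hy hsell p t
      have h2 := inventory_nonneg hy p t
      -- Discounting is dropped, so the final bound does not depend on `β`.
      have h3 : β ^ t ≤ 1 := pow_le_one₀ hβ.1.le hβ.2.le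
      refine (mul_le_of_le_one_left (by positivity) h3).trans ?_
      gcongr)
  rw [integral_lowPrices_mul (h := fun x => |x| + 1 / 2) (by fun_prop)] at h
  exact h

/-- An upper bound on the performance when everything is sold at prices above `m` but at least `c`
is kept while prices are below `m'`. -/
lemma performance_le (hy : IsFeasible y) (hm : Measurable fun q : ℝ × ℝ => y q.1 q.2)
    (hβ : β ∈ Ioo (0 : ℝ) 1) {m : ℝ} (hm0 : 0 ≤ m)
    (hsell : ∀ x, 0 ≤ x → ∀ p, m ≤ p → y x p = 0) {c m' : ℝ} (hc0 : 0 ≤ c) (hc1 : c ≤ 1)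
    (hkeep : ∀ x, c ≤ x → ∀ p ≤ m', c ≤ y x p) :
    performance (expMeasure 1) β quadCost y 1 ≤ m + 4 * Real.exp (m / 2)
      - c ^ 2 / 2 * ((expMeasure 1).real (Iic m') / (1 - β * (expMeasure 1).real (Iic m'))) := by
  set r := (expMeasure 1).real (Iic m) with hrdef
  set q := (expMeasure 1).real (Iic m') with hqdef
  set D := ∫ x, max (x - m) 0 ∂(expMeasure 1) with hD
  have hr : r = 1 - Real.exp (-m) := measureReal_Iic_expMeasure hm0
  have hr0 : 0 ≤ r := measureReal_nonneg
  have hr1 : r < 1 := by rw [hr]; linarith [Real.exp_pos (-m)]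
  have hq0 : 0 ≤ q := measureReal_nonneg
  have hq1 : q ≤ 1 := measureReal_le_one
  have hD0 : 0 ≤ D := integral_nonneg fun x => le_max_right _ _
  have hDr : D / (1 - r) ≤ 4 * Real.exp (m / 2) := by
    rw [hr, sub_sub_cancel, div_le_iff₀ (Real.exp_pos _), mul_assoc, ← Real.exp_add]
    refine (integral_max_sub_zero_le m).trans_eq ?_
    ring_nf
  set X : ℕ → ℝ := fun t => ∫ p, inventory y 1 p t ∂pathMeasure with hX
  have hXi : ∀ t, Integrable (fun p => inventory y 1 p t) pathMeasure := fun t => by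
    simpa using integrable_inventory_pow hy hm t 1
  -- Revenue is split at the price `m`: the part up to `m` telescopes to at most `m`, and the excess
  -- is earned only while stock remains, giving a geometric series with sum `D / (1 - r)`. Storage
  -- is paid after the sale, so its indicator involves `t + 1` prices, whence `q * (β * q) ^ t`.
  have hstage : ∀ t, ∫ p, stageReward β quadCost y 1 p t ∂pathMeasure
      ≤ m * (X t - X (t + 1)) + r ^ t * D - c ^ 2 / 2 * (q * (β * q) ^ t) := by
    intro t
    have i1 : Integrable (fun p : ℕ → ℝ =>
        m * (inventory y 1 p t - inventory y 1 p (t + 1))) pathMeasure :=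
      ((hXi t).sub (hXi (t + 1))).const_mul m
    have i2 := integrable_lowPrices_mul (integrable_max_sub_zero m) m t
    have i3 := (integrable_lowPrices m' (t + 1)).const_mul (β ^ t * (c ^ 2 / 2))
    have i12 : Integrable (fun p : ℕ → ℝ => m * (inventory y 1 p t - inventory y 1 p (t + 1))
        + lowPrices m t p * max (p t - m) 0) pathMeasure := i1.add i2
    have h := integral_mono (integrable_stageReward hy hm hβ t) (i12.sub i3) (fun p => by
      have h0 := inventory_nonneg hy p t
      have h1 := inventory_nonneg hy p (t + 1)
      have h2 := inventory_succ_le hy p t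
      have h4 := inventory_le_lowPrices hy hsell p t
      have h5 := lowPrices_le_inventory hy hc1 hkeep p (t + 1)
      have hβ0 : 0 ≤ β ^ t := pow_nonneg hβ.1.le t
      have hβ1 : β ^ t ≤ 1 := pow_le_one₀ hβ.1.le hβ.2.le
      simp only [Pi.sub_apply, stageReward, quadCost]
      set u := inventory y 1 p t
      set z := inventory y 1 p (t + 1)
      have hz : c ^ 2 * lowPrices m' (t + 1) p ≤ z ^ 2 := by
        rcases lowPrices_eq_zero_or_one m' (t + 1) p with h | h
        · rw [h]; nlinarith [sq_nonneg z]
        · rw [h, mul_one] at h5 ⊢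
          exact pow_le_pow_left₀ hc0 h5 2
      have hmax0 : 0 ≤ max (p t - m) 0 := le_max_right _ _
      have hp : p t * (u - z) ≤ m * (u - z) + lowPrices m t p * max (p t - m) 0 := by
        have e1 : (p t - m) * (u - z) ≤ max (p t - m) 0 * (u - z) :=
          mul_le_mul_of_nonneg_right (le_max_left _ _) (by linarith)
        have e2 : max (p t - m) 0 * (u - z) ≤ max (p t - m) 0 * lowPrices m t p :=
          mul_le_mul_of_nonneg_left (by linarith) hmax0
        linarith
      have hnn : 0 ≤ m * (u - z) + lowPrices m t p * max (p t - m) 0 :=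
        add_nonneg (mul_nonneg hm0 (by linarith)) (mul_nonneg (lowPrices_nonneg _ _ _) hmax0)
      have e3 := mul_le_mul_of_nonneg_left hp hβ0
      have e4 := mul_le_of_le_one_left hnn hβ1
      have e5 := mul_le_mul_of_nonneg_left hz hβ0
      nlinarith)
    simp only [Pi.sub_apply] at h
    rw [integral_sub i12 i3, integral_add i1 i2, integral_const_mul, integral_const_mul,
      integral_sub (hXi t) (hXi (t + 1)), integral_lowPrices_mul (h := fun x => max (x - m) 0) (by fun_prop),
      integral_lowPrices] at h
    refine h.trans_eq ?_
    rw [mul_pow]; ring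
  have hβq : β * q < 1 := by nlinarith [hβ.1, hβ.2]
  have hβq0 : 0 ≤ β * q := mul_nonneg hβ.1.le hq0
  have hgeo := ((hasSum_geometric_of_lt_one hβq0 hβq).mul_left q).mul_left (c ^ 2 / 2)
  rw [← div_eq_mul_inv] at hgeo
  refine le_of_tendsto_of_tendsto' (hasSum_performance hy hm hβ).tendsto_sum_nat
    (hgeo.tendsto_sum_nat.const_sub (m + 4 * Real.exp (m / 2))) fun n => ?_
  refine (Finset.sum_le_sum fun t _ => hstage t).trans ?_
  rw [Finset.sum_sub_distrib, Finset.sum_add_distrib, ← Finset.mul_sum, Finset.sum_range_sub',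
    ← Finset.sum_mul]
  have hX0 : X 0 = 1 := by simp [hX, inventory]
  have hXn : 0 ≤ X n := integral_nonneg fun p => inventory_nonneg hy p n
  have hgr : (∑ t ∈ Finset.range n, r ^ t) * D ≤ D / (1 - r) := by
    rw [div_eq_inv_mul]
    refine mul_le_mul_of_nonneg_right ?_ hD0
    exact (summable_geometric_of_lt_one hr0 hr1).sum_le_tsum _ (fun t _ => pow_nonneg hr0 t)
      |>.trans_eq (tsum_geometric_of_lt_one hr0 hr1)
  have : m * (X 0 - X n) ≤ m := by rw [hX0]; nlinarith
  linarith

end Performance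

/-- Sample-based feasible policies that depend measurably on the sample have well-defined expected
out-of-sample performance. -/
lemma performanceWellDefined {N : ℕ} {y : (Fin N → ℝ) → ℝ → ℝ → ℝ} {β : ℝ}
    (hβ : β ∈ Ioo (0 : ℝ) 1) (hy : ∀ s, IsFeasible (y s))
    (hm : Measurable fun q : (Fin N → ℝ) × ℝ × ℝ => y q.1 q.2.1 q.2.2) :
    PerformanceWellDefined (expMeasure 1) β quadCost y 1 := by
  have hms : ∀ s, Measurable fun q : ℝ × ℝ => y s q.1 q.2 := fun s =>
    hm.comp (measurable_prodMk_left (x := s))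
  refine ⟨fun s => ae_summable_and_integrable_tsum (integrable_stageReward (hy s) (hms s) hβ)
    (summable_integral_norm_stageReward (hy s) (hms s) hβ), ?_⟩
  refine (integrable_const ((1 - β)⁻¹ * stageBound)).mono' ?_ (ae_of_all _ fun s => ?_)
  · refine Measurable.aestronglyMeasurable ?_
    refine measurable_of_tendsto_metrizable (f := fun n s =>
      ∑ t ∈ Finset.range n, ∫ p, stageReward β quadCost (y s) 1 p t ∂pathMeasure)
      (fun n => Finset.measurable_sum _ fun t _ => ?_)
      (tendsto_pi_nhds.2 fun s => (hasSum_performance (hy s) (hms s) hβ).tendsto_sum_nat)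
    exact (measurable_stageReward hm β t).stronglyMeasurable.integral_prod_right.measurable
  · rw [← (hasSum_performance (hy s) (hms s) hβ).tsum_eq]
    refine tsum_of_norm_bounded ((hasSum_geometric_of_lt_one hβ.1.le hβ.2).mul_right _) fun t => ?_
    exact (norm_integral_le_integral_norm _).trans
      (integral_norm_stageReward_le (hy s) (hms s) hβ t)

/-! ### Performance of the sample-based policies -/

section Congruence

/-- Trajectories of a feasible policy stay nonnegative, so values at negative inventories, which the
Bellman equation leaves arbitrary, do not matter. -/
lemma stageReward_congr {y y' : ℝ → ℝ → ℝ} (hy' : IsFeasible y')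
    (h : ∀ x, 0 ≤ x → ∀ p, y x p = y' x p) (β : ℝ) :
    stageReward β quadCost y 1 = stageReward β quadCost y' 1 := by
  have hinv : ∀ p t, inventory y 1 p t = inventory y' 1 p t := by
    intro p t
    induction t with
    | zero => rfl
    | succ t ih => rw [inventory, inventory, ih, h _ (inventory_nonneg hy' p t)]
  funext p t
  simp only [stageReward, hinv]

variable {N : ℕ} {y y' : (Fin N → ℝ) → ℝ → ℝ → ℝ} {β : ℝ}

lemma performance_congr {y y' : ℝ → ℝ → ℝ}
    (h : stageReward β quadCost y 1 = stageReward β quadCost y' 1) :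
    performance (expMeasure 1) β quadCost y 1 = performance (expMeasure 1) β quadCost y' 1 := by
  simp only [performance, totalReward, h]

lemma performanceWellDefined_congr
    (h : ∀ s, stageReward β quadCost (y s) 1 = stageReward β quadCost (y' s) 1)
    (hw : PerformanceWellDefined (expMeasure 1) β quadCost y' 1) :
    PerformanceWellDefined (expMeasure 1) β quadCost y 1 := by
  have ht : ∀ s, totalReward β quadCost (y s) 1 = totalReward β quadCost (y' s) 1 := fun s => by
    funext p; simp only [totalReward, h]
  simp only [PerformanceWellDefined, performance, ht, h] at hw ⊢
  exact hw

lemma expectedPerformance_congr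
    (h : ∀ s, stageReward β quadCost (y s) 1 = stageReward β quadCost (y' s) 1) :
    expectedPerformance (expMeasure 1) β quadCost y 1
      = expectedPerformance (expMeasure 1) β quadCost y' 1 := by
  simp only [expectedPerformance, fun s => performance_congr (h s)]

end Congruence

variable {N : ℕ} {β : ℝ}

lemma isFeasible_optPolicy (hβ : β ∈ Ioo (0 : ℝ) 1) (a : Fin N → ℝ) :
    IsFeasible (optPolicy β a) := fun x hx p => by
  simpa [hx] using optPolicy_mem hβ a x p

lemma measurable_optPolicy_apply (hβ : β ∈ Ioo (0 : ℝ) 1) (a : Fin N → ℝ) :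
    Measurable fun q : ℝ × ℝ => optPolicy β a q.1 q.2 :=
  (measurable_optPolicy hβ).comp (measurable_prodMk_left (x := a))

lemma isMPCPolicy_iff (C : ℝ → ℝ) (s : Fin N → ℝ) (y : ℝ → ℝ → ℝ) :
    IsMPCPolicy β C s y ↔ IsSDPPolicy β C (fun _ : Fin 1 => sampleMean s) y := by
  simp [IsMPCPolicy, IsSDPPolicy, empiricalMeasure]

/-- The law of `N` independent `Exponential(1)` price samples. -/
abbrev sampleMeasure (N : ℕ) : Measure (Fin N → ℝ) := Measure.pi fun _ : Fin N => expMeasure 1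

lemma ae_nonneg_sampleMeasure (N : ℕ) : ∀ᵐ s ∂(sampleMeasure N), ∀ i, 0 ≤ s i :=
  ae_all_iff.2 fun i =>
    (measurePreserving_eval (fun _ : Fin N => expMeasure 1) i).quasiMeasurePreserving.ae
      ae_nonneg_expMeasure

lemma sampleMean_nonneg {s : Fin N → ℝ} (hs : ∀ i, 0 ≤ s i) : 0 ≤ sampleMean s :=
  div_nonneg (Finset.sum_nonneg fun i _ => hs i) (Nat.cast_nonneg N)

lemma measurable_sampleMean : Measurable (sampleMean : (Fin N → ℝ) → ℝ) := by
  unfold sampleMean; fun_prop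

/-- The only place where `N = 1` would fail: `exp (c * x)` is integrable against `exp (-x)` for `c =
1 / N < 1`. -/
lemma integrable_exp_sampleMean (hN : 2 ≤ N) :
    Integrable (fun s : Fin N → ℝ => Real.exp (sampleMean s)) (sampleMeasure N) := by
  have hN' : (1 : ℝ) < N := by exact_mod_cast hN
  have h := Integrable.fintype_prod (μ := fun _ : Fin N => expMeasure 1)
    (f := fun (_ : Fin N) x => Real.exp ((N : ℝ)⁻¹ * x))
    fun _ => integrable_exp_mul_expMeasure (inv_lt_one_of_one_lt₀ hN')
  refine h.congr (ae_of_all _ fun s => ?_)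
  simp only [sampleMean, ← Real.exp_sum, ← Finset.mul_sum, div_eq_inv_mul]

lemma integrable_prod_exp_half :
    Integrable (fun s : Fin N → ℝ => ∏ i, Real.exp (s i / 2)) (sampleMeasure N) :=
  Integrable.fintype_prod (μ := fun _ : Fin N => expMeasure 1)
    (f := fun (_ : Fin N) x => Real.exp (x / 2)) fun _ => integrable_exp_half_expMeasure

lemma performanceWellDefined_SDP (hβ : β ∈ Ioo (0 : ℝ) 1) :
    PerformanceWellDefined (N := N) (expMeasure 1) β quadCost (optPolicy β) 1 :=
  performanceWellDefined hβ (isFeasible_optPolicy hβ) (measurable_optPolicy hβ)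

lemma performanceWellDefined_MPC (hβ : β ∈ Ioo (0 : ℝ) 1) :
    PerformanceWellDefined (N := N) (expMeasure 1) β quadCost
      (fun s => optPolicy β fun _ : Fin 1 => sampleMean s) 1 := by
  refine performanceWellDefined hβ (fun s => isFeasible_optPolicy hβ _) ?_
  exact (measurable_optPolicy hβ).comp (f := fun q : (Fin N → ℝ) × ℝ × ℝ =>
    ((fun _ : Fin 1 => sampleMean q.1), q.2)) ((measurable_pi_lambda _ fun _ =>
      measurable_sampleMean.comp measurable_fst).prodMk measurable_snd)

lemma abs_expectedPerformance_MPC_le (hN : 2 ≤ N) (hβ : β ∈ Ioo (0 : ℝ) 1) :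
    |expectedPerformance (N := N) (expMeasure 1) β quadCost
      (fun s => optPolicy β fun _ : Fin 1 => sampleMean s) 1|
      ≤ ∫ s, stageBound * Real.exp (sampleMean s) ∂(sampleMeasure N) := by
  rw [expectedPerformance, ← Real.norm_eq_abs]
  refine norm_integral_le_of_norm_le ((integrable_exp_sampleMean hN).const_mul _) ?_
  filter_upwards [ae_nonneg_sampleMeasure N] with s hs
  exact abs_performance_le (isFeasible_optPolicy hβ _) (measurable_optPolicy_apply hβ _) hβ
    (sampleMean_nonneg hs) fun x _ p hp =>
      optPolicy_eq_zero hβ (sampleMean_nonneg hs) (fun _ => le_rfl) x hp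

/-! ### The performance of SDP policies diverges -/

/-- Revenue alone contributes at most `6 ∏ exp (s i / 2)`. -/
lemma performance_SDP_le (hβ : β ∈ Ioo (0 : ℝ) 1) {s : Fin N → ℝ} (hs : ∀ i, 0 ≤ s i) {i : Fin N}
    (hi : ∀ j, s j ≤ s i) {c : ℝ} (hc0 : 0 ≤ c) (hc1 : c ≤ 1)
    (hkeep : ∀ x, c ≤ x → ∀ p ≤ s i - 1, c ≤ optPolicy β s x p) :
    performance (expMeasure 1) β quadCost (optPolicy β s) 1 ≤ 6 * ∏ j, Real.exp (s j / 2)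
      - c ^ 2 / 2 * ((expMeasure 1).real (Iic (s i - 1))
        / (1 - β * (expMeasure 1).real (Iic (s i - 1)))) := by
  have h := performance_le (isFeasible_optPolicy hβ s) (measurable_optPolicy_apply hβ s) hβ (hs i)
    (fun x _ p hp => optPolicy_eq_zero hβ (hs i) hi x hp) hc0 hc1 hkeep
  -- For nonnegative samples every factor is at least one, so the product dominates the term of the
  -- maximum; unlike the maximum, it factorizes under the product measure.
  have h1 : Real.exp (s i / 2) ≤ ∏ j, Real.exp (s j / 2) := by
    rw [← Real.exp_sum]
    exact Real.exp_le_exp.2 (Finset.single_le_sum (f := fun j => s j / 2)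
      (fun j _ => by have := hs j; positivity) (Finset.mem_univ i))
  have h2 := Real.add_one_le_exp (s i / 2)
  linarith

/-- The weight `exp (s i)` on the event that the sample `i` is the largest one and lies in `[2, K]`
while all other samples are at most `2`. -/
def topSampleWeight (i : Fin N) (K : ℝ) (s : Fin N → ℝ) : ℝ :=
  ∏ j, (if j = i then (Icc 2 K).indicator Real.exp else (Iic 2).indicator 1) (s j)

lemma topSampleWeight_eq (i : Fin N) (K : ℝ) (s : Fin N → ℝ) :
    topSampleWeight i K s = 0 ∨
      (topSampleWeight i K s = Real.exp (s i) ∧ s i ∈ Icc 2 K ∧ ∀ j, s j ≤ s i) := by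
  unfold topSampleWeight
  by_cases h : s i ∈ Icc 2 K ∧ ∀ j, j ≠ i → s j ∈ Iic 2
  · right
    refine ⟨?_, h.1, fun j => ?_⟩
    · rw [Finset.prod_eq_single i]
      · rw [if_pos rfl, indicator_of_mem h.1]
      · intro j _ hj
        rw [if_neg hj, indicator_of_mem (h.2 j hj), Pi.one_apply]
      · simp
    · by_cases hj : j = i
      · rw [hj]
      · exact (h.2 j hj).trans h.1.1
  · left
    rw [not_and_or] at h
    rcases h with h | h
    · exact Finset.prod_eq_zero (Finset.mem_univ i) (by rw [if_pos rfl, indicator_of_notMem h])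
    · push Not at h
      obtain ⟨j, hj, hj'⟩ := h
      exact Finset.prod_eq_zero (Finset.mem_univ j) (by rw [if_neg hj, indicator_of_notMem hj'])

lemma integrable_topSampleWeight (i : Fin N) (K : ℝ) :
    Integrable (topSampleWeight i K) (sampleMeasure N) := by
  refine Integrable.fintype_prod (μ := fun _ : Fin N => expMeasure 1) fun j => ?_
  split_ifs
  · rw [integrable_indicator_iff measurableSet_Icc]
    exact Real.continuous_exp.continuousOn.integrableOn_compact isCompact_Icc
  · exact (integrable_const (1 : ℝ)).indicator measurableSet_Iic

lemma integral_topSampleWeight (i : Fin N) {K : ℝ} (hK : 2 ≤ K) :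
    ∫ s, topSampleWeight i K s ∂(sampleMeasure N)
      = (K - 2) * (expMeasure 1).real (Iic 2) ^ (N - 1) := by
  unfold topSampleWeight
  rw [integral_fintype_prod_eq_prod (μ := fun _ : Fin N => expMeasure 1),
    ← Finset.mul_prod_erase _ _ (Finset.mem_univ i), if_pos rfl, integral_indicator_Icc_exp hK]
  congr 1
  rw [Finset.prod_congr rfl fun j hj => by
    rw [if_neg (Finset.ne_of_mem_erase hj), integral_indicator_one measurableSet_Iic]]
  simp

/-- With `e = exp (-(m - 1))`, the numerator `1 - e` is at least `1 / 2`. Since `1 - β ≤ exp (-K) ≤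
e`, the denominator is at most `2 * e`: discounting is too weak to shorten the wait. -/
lemma exp_le_expected_holding_time (hβ : β ∈ Ioo (0 : ℝ) 1) {m K : ℝ} (hm : m ∈ Icc 2 K)
    (hβK : 1 - β ≤ Real.exp (-K)) :
    Real.exp (m - 1) / 4 ≤ (expMeasure 1).real (Iic (m - 1))
      / (1 - β * (expMeasure 1).real (Iic (m - 1))) := by
  rw [measureReal_Iic_expMeasure (by linarith [hm.1])]
  set e := Real.exp (-(m - 1)) with he
  have he0 : 0 < e := Real.exp_pos _
  have hee : Real.exp (m - 1) * e = 1 := by rw [he, ← Real.exp_add]; simp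
  have hE : 2 ≤ Real.exp (m - 1) := by linarith [Real.add_one_le_exp (m - 1), hm.1]
  have he2 : e ≤ 1 / 2 := by nlinarith
  have hK : Real.exp (-K) ≤ e := Real.exp_le_exp.2 (by linarith [hm.2])
  have hden : 0 < 1 - β * (1 - e) := by nlinarith [hβ.1, hβ.2]
  rw [le_div_iff₀ hden]
  have : 1 - β * (1 - e) ≤ 2 * e := by nlinarith [hβ.2]
  nlinarith

lemma expectedPerformance_SDP_le (i : Fin N) {K : ℝ} (hK : 2 ≤ K) (hβ : β ∈ Ioo (0 : ℝ) 1)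
    (hβK : (1 - β) * K ≤ 1 / (4 * N)) (hβK' : 1 - β ≤ Real.exp (-K)) :
    expectedPerformance (N := N) (expMeasure 1) β quadCost (optPolicy β) 1
      ≤ 6 * ∫ s, ∏ j, Real.exp (s j / 2) ∂(sampleMeasure N)
        - (1 / (4 * N : ℝ)) ^ 2 / 8 * Real.exp (-1)
          * ((K - 2) * (expMeasure 1).real (Iic 2) ^ (N - 1)) := by
  rw [← integral_topSampleWeight i hK, ← integral_const_mul, ← integral_const_mul,
    ← integral_sub (integrable_prod_exp_half.const_mul _)
      ((integrable_topSampleWeight i K).const_mul _)]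
  refine integral_mono_ae (performanceWellDefined_SDP hβ).2
    ((integrable_prod_exp_half.const_mul _).sub ((integrable_topSampleWeight i K).const_mul _)) ?_
  filter_upwards [ae_nonneg_sampleMeasure N] with s hs
  rcases topSampleWeight_eq i K s with h | ⟨h, hi, hmax⟩
  · have : Nonempty (Fin N) := ⟨i⟩
    obtain ⟨k, hk⟩ := Finite.exists_max s
    have := performance_SDP_le hβ hs hk le_rfl zero_le_one
      fun x hx p _ => (isFeasible_optPolicy hβ s x hx p).1
    simpa [h] using this
  · have hN : (1 : ℝ) ≤ N := by exact_mod_cast i.pos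
    have hc1 : 1 / (4 * N : ℝ) ≤ 1 := by
      rw [div_le_one (by positivity)]; linarith
    have h1 := performance_SDP_le hβ hs hmax (by positivity) hc1
      fun x hx p hp => le_optPolicy hβ hmax (by linarith [hi.1]) hi.2 hβK hx hp
    have h2 := mul_le_mul_of_nonneg_left (exp_le_expected_holding_time hβ hi hβK')
      (show 0 ≤ (1 / (4 * N : ℝ)) ^ 2 / 2 by positivity)
    refine h1.trans ?_
    rw [h]
    have h3 : Real.exp (s i - 1) = Real.exp (-1) * Real.exp (s i) := by
      rw [← Real.exp_add]; ring_nf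
    rw [h3] at h2
    linarith

lemma tendsto_expectedPerformance_SDP (i : Fin N) :
    Tendsto (fun β => expectedPerformance (N := N) (expMeasure 1) β quadCost (optPolicy β) 1)
      (𝓝[<] 1) atBot := by
  have hN : (0 : ℝ) < N := by exact_mod_cast i.pos
  rw [tendsto_atBot]
  intro b
  set G := 6 * ∫ s, ∏ j, Real.exp (s j / 2) ∂(sampleMeasure N)
  set ρ := (expMeasure 1).real (Iic 2) with hρ
  have hρ0 : 0 < ρ := by
    rw [hρ, measureReal_Iic_expMeasure (by norm_num), sub_pos, Real.exp_lt_one_iff]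
    norm_num
  set κ := (1 / (4 * N : ℝ)) ^ 2 / 8 * Real.exp (-1) * ρ ^ (N - 1) with hκ
  have hκ0 : 0 < κ := by positivity
  -- Chosen so that the expected storage cost `κ * (K - 2)` equals `|G - b|`, which brings the bound
  -- `G` down to `b`.
  set K := 2 + |G - b| / κ with hKdef
  have hK : 2 ≤ K := by have : 0 ≤ |G - b| / κ := by positivity
                        linarith
  have hK0 : 0 < K := by linarith
  have hδ : 0 < min (1 / (4 * N * K)) (Real.exp (-K)) := lt_min (by positivity) (Real.exp_pos _)
  have ha : max 0 (1 - min (1 / (4 * N * K)) (Real.exp (-K))) < 1 :=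
    max_lt one_pos (by linarith)
  filter_upwards [Ioo_mem_nhdsLT ha] with β hβ
  have hβ' := max_lt_iff.1 hβ.1
  have hlt : 1 - β < min (1 / (4 * N * K)) (Real.exp (-K)) := by linarith [hβ'.2]
  obtain ⟨h1, h2⟩ := lt_min_iff.1 hlt
  have h3 : (1 - β) * K ≤ 1 / (4 * N) := by
    calc (1 - β) * K ≤ 1 / (4 * N * K) * K := mul_le_mul_of_nonneg_right h1.le hK0.le
      _ = 1 / (4 * N) := by field_simp
  refine (expectedPerformance_SDP_le i hK ⟨hβ'.1, hβ.2⟩ h3 h2.le).trans ?_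
  have h4 : (1 / (4 * N : ℝ)) ^ 2 / 8 * Real.exp (-1) * ((K - 2) * ρ ^ (N - 1)) = |G - b| := by
    calc _ = κ * (K - 2) := by rw [hκ]; ring
      _ = |G - b| := by rw [hKdef, add_sub_cancel_left]; field_simp
  rw [h4]
  linarith [le_abs_self (G - b)]

end RevenueOpt

end

theorem proposition4 (N : ℕ) (hN : 2 ≤ N) :
    -- sample-based SDP and MPC policies exist
    (∀ β ∈ Set.Ioo (0 : ℝ) 1, ∀ s : Fin N → ℝ,
      (∃ y, RevenueOpt.IsSDPPolicy β RevenueOpt.quadCost s y) ∧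
      (∃ y, RevenueOpt.IsMPCPolicy β RevenueOpt.quadCost s y)) ∧
    -- SDP: well defined, and unbounded below as the discount factor tends to one
    (∀ yS : ℝ → (Fin N → ℝ) → ℝ → ℝ → ℝ,
      (∀ β ∈ Set.Ioo (0 : ℝ) 1, ∀ s : Fin N → ℝ,
        RevenueOpt.IsSDPPolicy β RevenueOpt.quadCost s (yS β s)) →
      (∀ β ∈ Set.Ioo (0 : ℝ) 1,
        RevenueOpt.PerformanceWellDefined (expMeasure 1) β RevenueOpt.quadCost (yS β) 1) ∧
      Tendsto (fun β : ℝ =>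
          RevenueOpt.expectedPerformance (expMeasure 1) β RevenueOpt.quadCost (yS β) 1)
        (𝓝[<] 1) atBot) ∧
    -- MPC: well defined, and bounded
    (∀ yM : ℝ → (Fin N → ℝ) → ℝ → ℝ → ℝ,
      (∀ β ∈ Set.Ioo (0 : ℝ) 1, ∀ s : Fin N → ℝ,
        RevenueOpt.IsMPCPolicy β RevenueOpt.quadCost s (yM β s)) →
      (∀ β ∈ Set.Ioo (0 : ℝ) 1,
        RevenueOpt.PerformanceWellDefined (expMeasure 1) β RevenueOpt.quadCost (yM β) 1) ∧
      ∃ K : ℝ, ∀ β ∈ Set.Ioo (0 : ℝ) 1,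
        |RevenueOpt.expectedPerformance (expMeasure 1) β RevenueOpt.quadCost (yM β) 1| ≤ K) := by
  refine ⟨fun β hβ s => ⟨⟨_, RevenueOpt.isSDPPolicy_optPolicy hβ s⟩,
    ⟨_, (RevenueOpt.isMPCPolicy_iff _ _ _).2 (RevenueOpt.isSDPPolicy_optPolicy hβ _)⟩⟩,
    fun yS hS => ?_, fun yM hM => ?_⟩
  · have hc : ∀ β ∈ Set.Ioo (0 : ℝ) 1, ∀ s, RevenueOpt.stageReward β RevenueOpt.quadCost (yS β s) 1
        = RevenueOpt.stageReward β RevenueOpt.quadCost (RevenueOpt.optPolicy β s) 1 :=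
      fun β hβ s => RevenueOpt.stageReward_congr (RevenueOpt.isFeasible_optPolicy hβ s)
        (fun _ hx p => RevenueOpt.eq_optPolicy hβ (hS β hβ s) hx p) β
    refine ⟨fun β hβ => RevenueOpt.performanceWellDefined_congr (hc β hβ)
      (RevenueOpt.performanceWellDefined_SDP hβ), ?_⟩
    refine (RevenueOpt.tendsto_expectedPerformance_SDP (⟨0, by omega⟩ : Fin N)).congr' ?_
    filter_upwards [Ioo_mem_nhdsLT one_pos] with β hβ
    exact (RevenueOpt.expectedPerformance_congr (hc β hβ)).symm
  · have hc : ∀ β ∈ Set.Ioo (0 : ℝ) 1, ∀ s, RevenueOpt.stageReward β RevenueOpt.quadCost (yM β s) 1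
        = RevenueOpt.stageReward β RevenueOpt.quadCost
          (RevenueOpt.optPolicy β fun _ : Fin 1 => RevenueOpt.sampleMean s) 1 :=
      fun β hβ s => RevenueOpt.stageReward_congr (RevenueOpt.isFeasible_optPolicy hβ _)
        (fun _ hx p => RevenueOpt.eq_optPolicy hβ
          ((RevenueOpt.isMPCPolicy_iff _ _ _).1 (hM β hβ s)) hx p) β
    refine ⟨fun β hβ => RevenueOpt.performanceWellDefined_congr (hc β hβ)
      (RevenueOpt.performanceWellDefined_MPC hβ),
      ∫ s, RevenueOpt.stageBound * Real.exp (RevenueOpt.sampleMean s)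
        ∂(RevenueOpt.sampleMeasure N), fun β hβ => ?_⟩
    rw [RevenueOpt.expectedPerformance_congr (hc β hβ)]
    exact RevenueOpt.abs_expectedPerformance_MPC_le hN hβ
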